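/- **Model.** Jobs arrive at the ports $\ell=1,\dots,L$ of a bipartite graph according to independent Poisson processes with rates $\lambda_\ell\ge 0$ and are routed to one of the $N$ servers adjacent to the port; every port and every server has at least one neighbour. There are $M$ server types with service rates $\mu_1>\dots>\mu_M>0$ and proportions $\alpha_m>0$, $\sum_m\alpha_m=1$; exactly $N\alpha_m$ servers have type $m$, and service times at type-$m$ servers are independent exponentials with mean $1/\mu_m$. Every server holds at most $b$ jobs (including the one in service) and serves first-come-first-served; a job routed to a server that already holds $b$ jobs is blocked and lost. Assume $\lambda_\Sigma=\sum_\ell\lambda_\ell<N\sum_{m=1}^M\mu_m\alpha_m$. The routing policy is one of the following. *JFSQ*: among the adjacent servers with the shortest queue choose one with the largest service rate, ties broken uniformly at random. *JFIQ*: if some adjacent server is idle, choose an idle adjacent server with the largest service rate, ties broken uniformly at random; otherwise choose a uniformly random adjacent server. The queue lengths form a finite continuous-time Markov chain; $\bar{\mathbf Q}$ denotes its steady state and $p_{\mathcal B}$ the steady-state probability that an arriving job is blocked (defined when $\lambda_\Sigma>0$). Let $C_m(\mathbf q)$ be the number of jobs in type-$m$ servers divided by $N$. **Parameters.** Let $\lambda=\lambda_\Sigma/N$,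 let $K$ be the least integer with $N\sum_{m=1}^K\mu_m\alpha_m>\lambda_\Sigma$, define $\beta$ by $\lambda_\Sigma=N\sum_{m=1}^K\mu_m\alpha_m(1-\beta)$, and put $\hat\beta=\beta\sum_{m=1}^K\alpha_m$, $C^*=\sum_{m=1}^{K-1}\alpha_m+\frac{1}{\mu_K}\bigl(\lambda-\sum_{m=1}^{K-1}\mu_m\alpha_m\bigr)$, $\tau_{1K}=\mu_1/\mu_K$, $\tau_{1M}=\mu_1/\mu_M$, $\tau_{KM}=\mu_K/\mu_M$. Let $\mathcal R_k$ be the set of servers of types $1,\dots,k$, and for a set $\mathcal I$ of servers let $D_{\mathcal I}$ be the total arrival rate of the ports not adjacent to any server in $\mathcal I$. **Assumption 1 (buffer size).** $0<\epsilon\le\hat\beta/4$ and $6\sqrt{\tau_{1K}}\le b\le\Bigl\lfloor\bigl(\frac{\epsilon^2N}{1152\,\tau_{1K}\ln N}\bigr)^{1/5}\Bigr\rfloor$. **Assumption 2 (well-connectedness).** $D_{\mathcal I}\le N\tilde d_1$ for all $\mathcal I\subseteq\mathcal R_{K-1}$ with $|\mathcal I|\ge N\frac{\epsilon}{6b^2}$,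 and $D_{\mathcal I}\le N\tilde d_2$ for all $\mathcal I\subseteq\mathcal R_K$ with $|\mathcal I|\ge N\frac{\hat\beta}{2}$, where $\tilde d_1\le\frac{\epsilon\mu_K}{12b^3}$ and $\tilde d_2\le\frac{\epsilon\mu_K}{2b}$. **Theorem 1.** For all $M$, $(\mu_m)$, $(\alpha_m)$ there is $N_0$ such that for every $N\ge N_0$, every system with $N$ servers of these types (any graph, arrival rates and buffer size), either policy, and all $\epsilon,\tilde d_1,\tilde d_2$ satisfying Assumptions 1 and 2: (i) $\displaystyle \mathbb E\Bigl[\max\Bigl(\sum_{m=1}^K C_m(\bar{\mathbf Q})-(C^*+\epsilon),\,0\Bigr)\Bigr]\le\frac{52\,\tau_{1K}b^2}{\epsilon N}$; (ii) if $K<M$, then $\displaystyle \mathbb E\Bigl[\sum_{m=1}^M C_m(\bar{\mathbf Q})\Bigr]\le C^*+\Bigl(1+\frac{\tau_{KM}}2\Bigr)\epsilon+2\sqrt{\frac{5\tau_{1M}b\ln N}{N}}+60b^2\sqrt{\frac{26\,\tau_{1K}\tau_{1M}}{\hat\beta\epsilon N}}$; (iii) if $\lambda>0$, then $\displaystyle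 p_{\mathcal B}\le\frac{\tilde d_2}{\lambda}+\frac{52\,\tau_{1K}b^2}{\epsilon N}$. -/

import Mathlib

/-- The two routing policies: Join-the-Fastest-of-the-Shortest-Queues and
Join-the-Fastest-of-the-Idle-Queues. -/
inductive Policy : Type where
  | JFSQ : Policy
  | JFIQ : Policy

/-- The server types `1, …, M`: type `m` has service rate `μ m` and is a proportion `α m` of all
servers; types are ordered from the fastest to the slowest. Only the values of `μ` and `α` on
`{1, …, M}` matter. -/
structure ServerTypes where
  M : ℕ
  μ : ℕ → ℝ
  α : ℕ → ℝ
  μ_pos : ∀ m ∈ Finset.Icc 1 M, 0 < μ m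
  μ_strictAnti : ∀ m ∈ Finset.Icc 1 M, ∀ m' ∈ Finset.Icc 1 M, m < m' → μ m' < μ m
  α_pos : ∀ m ∈ Finset.Icc 1 M, 0 < α m
  α_sum : ∑ m ∈ Finset.Icc 1 M, α m = 1

/-- A bipartite load balancing system with `N` servers, `L` ports and buffer size `b` (the largest
number of jobs at a server, including the one in service). -/
structure LBSystem (S : ServerTypes) (N : ℕ) where
  /-- number of ports -/
  L : ℕ
  /-- edges between ports and servers -/
  edges : Finset (Fin L × Fin N)
  /-- Poisson arrival rate at each port -/
  rate : Fin L → ℝ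
  /-- type of each server -/
  serverType : Fin N → ℕ
  /-- buffer size -/
  b : ℕ
  port_connected : ∀ l, ∃ r, (l, r) ∈ edges
  server_connected : ∀ r, ∃ l, (l, r) ∈ edges
  rate_nonneg : ∀ l, 0 ≤ rate l
  serverType_mem : ∀ r, serverType r ∈ Finset.Icc 1 S.M
  serverType_card : ∀ m ∈ Finset.Icc 1 S.M,
    ((Finset.univ.filter fun r => serverType r = m).card : ℝ) = (N : ℝ) * S.α m
  capacity : ∑ l, rate l < (N : ℝ) * ∑ m ∈ Finset.Icc 1 S.M, S.μ m * S.α m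

namespace LBSystem

variable {S : ServerTypes} {N : ℕ} (sys : LBSystem S N)

/-! ### Graph -/

/-- Servers connected to port `l`. -/
def portNbrs (l : Fin sys.L) : Finset (Fin N) :=
  Finset.univ.filter fun r => (l, r) ∈ sys.edges

/-- Ports connected to server `r`. -/
def serverNbrs (r : Fin N) : Finset (Fin sys.L) :=
  Finset.univ.filter fun l => (l, r) ∈ sys.edges

/-- Ports connected to at least one server in `I`. -/
def setNbrs (I : Finset (Fin N)) : Finset (Fin sys.L) :=
  I.biUnion sys.serverNbrs

/-- `D_I`: total arrival rate of the ports not connected to `I`. -/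
noncomputable def D (I : Finset (Fin N)) : ℝ :=
  ∑ l ∈ (sys.setNbrs I)ᶜ, sys.rate l

/-- `R_k`: the servers of types `1, …, k`. -/
def R (k : ℕ) : Finset (Fin N) :=
  Finset.univ.filter fun r => sys.serverType r ≤ k

/-! ### The Markov chain of queue lengths -/

/-- Queue-length vectors, `0 ≤ q r ≤ b`. -/
abbrev State : Type := Fin N → Fin (sys.b + 1)

/-- Service rate of server `r`. -/
noncomputable def serviceRate (r : Fin N) : ℝ := S.μ (sys.serverType r)

/-- The servers in `A` with the largest service rate among `A`. -/
noncomputable def fastest (A : Finset (Fin N)) : Finset (Fin N) :=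
  A.filter fun r => ∀ r' ∈ A, sys.serviceRate r' ≤ sys.serviceRate r

/-- The servers connected to port `l` with the shortest queue. -/
def shortest (l : Fin sys.L) (q : sys.State) : Finset (Fin N) :=
  (sys.portNbrs l).filter fun r => ∀ r' ∈ sys.portNbrs l, q r ≤ q r'

/-- The idle servers connected to port `l`. -/
def idle (l : Fin sys.L) (q : sys.State) : Finset (Fin N) :=
  (sys.portNbrs l).filter fun r => (q r : ℕ) = 0

/-- The set from which the policy draws the destination of a job arriving at port `l`. -/
noncomputable def candidates (P : Policy) (l : Fin sys.L) (q : sys.State) : Finset (Fin N) :=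
  match P with
  | Policy.JFSQ => sys.fastest (sys.shortest l q)
  | Policy.JFIQ =>
      if (sys.idle l q).Nonempty then sys.fastest (sys.idle l q) else sys.portNbrs l

/-- Probability that a job arriving at port `l` in state `q` is routed to server `r`: the
destination is uniform on the candidates. -/
noncomputable def routeProb (P : Policy) (l : Fin sys.L) (q : sys.State) (r : Fin N) : ℝ :=
  if r ∈ sys.candidates P l q then 1 / ((sys.candidates P l q).card : ℝ) else 0

/-- `q'` is obtained from `q` by adding one job at server `r`. -/
def AddJob (q q' : sys.State) (r : Fin N) : Prop :=
  (q' r : ℕ) = (q r : ℕ) + 1 ∧ ∀ r', r' ≠ r → q' r' = q r'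

open Classical in
/-- Transition rate of the chain from `q` to `q'`: accepted arrivals (a job routed to a full server
is lost and leaves the state unchanged) and service completions. -/
noncomputable def transRate (P : Policy) (q q' : sys.State) : ℝ :=
  (∑ l, sys.rate l * ∑ r, sys.routeProb P l q r * (if sys.AddJob q q' r then 1 else 0))
    + ∑ r, sys.serviceRate r * (if sys.AddJob q' q r then 1 else 0)

/-- `p` is a stationary distribution of the chain (global balance). -/
structure IsStationary (P : Policy) (p : sys.State → ℝ) : Prop where
  nonneg : ∀ q, 0 ≤ p q
  sum_eq_one : ∑ q, p q = 1
  balance : ∀ q, p q * ∑ q', sys.transRate P q q' = ∑ q', p q' * sys.transRate P q' q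

/-- Expectation of `f` under the distribution `p` on states. -/
noncomputable def expect (p : sys.State → ℝ) (f : sys.State → ℝ) : ℝ :=
  ∑ q, p q * f q

/-! ### Performance measures -/

/-- `s_{m,i}(q)`: number of type `m` servers with at least `i` jobs, divided by `N`. -/
noncomputable def s (m i : ℕ) (q : sys.State) : ℝ :=
  ((Finset.univ.filter fun r => i ≤ (q r : ℕ) ∧ sys.serverType r = m).card : ℝ) / N

/-- `C_m(q)`: number of jobs in type `m` servers, divided by `N`. -/
noncomputable def C (m : ℕ) (q : sys.State) : ℝ :=
  ∑ i ∈ Finset.Icc 1 sys.b, sys.s m i q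

/-- Total arrival rate. -/
noncomputable def totalRate : ℝ := ∑ l, sys.rate l

/-- Probability that an arriving job is blocked when the queue lengths have distribution `p`:
the job arrives at port `l` with probability `rate l / totalRate`, sees the state `q` with
probability `p q`, and is lost if it is routed to a server that already holds `b` jobs. -/
noncomputable def blockProb (P : Policy) (p : sys.State → ℝ) : ℝ :=
  ∑ l, sys.rate l / sys.totalRate *
    sys.expect p fun q => ∑ r, sys.routeProb P l q r * (if (q r : ℕ) = sys.b then 1 else 0)

/-! ### Parameters -/

/-- Normalized arrival rate `λ`. -/
noncomputable def lam : ℝ := sys.totalRate / N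

/-- `K`: the least `k` such that the first `k` types can serve more than the total arrival rate. -/
noncomputable def K : ℕ :=
  sInf {k : ℕ | sys.totalRate < (N : ℝ) * ∑ m ∈ Finset.Icc 1 k, S.μ m * S.α m}

/-- `β`, the solution of `totalRate = N * (∑_{m ≤ K} μ_m α_m) * (1 - β)`. -/
noncomputable def beta : ℝ :=
  1 - sys.totalRate / ((N : ℝ) * ∑ m ∈ Finset.Icc 1 sys.K, S.μ m * S.α m)

/-- `β̂ = β * ∑_{m ≤ K} α_m`. -/
noncomputable def betaHat : ℝ := sys.beta * ∑ m ∈ Finset.Icc 1 sys.K, S.α m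

/-- `C^*_m` for `1 ≤ m ≤ K`. -/
noncomputable def CstarOf (m : ℕ) : ℝ :=
  if m < sys.K then S.α m
  else (sys.lam - ∑ m' ∈ Finset.Ico 1 sys.K, S.μ m' * S.α m') / S.μ sys.K

/-- `C^* = ∑_{m ≤ K} C^*_m`. -/
noncomputable def Cstar : ℝ := ∑ m ∈ Finset.Icc 1 sys.K, sys.CstarOf m

/-- `τ_{1K} = μ_1 / μ_K`. -/
noncomputable def tau1K : ℝ := S.μ 1 / S.μ sys.K

/-- `τ_{1M} = μ_1 / μ_M`. -/
noncomputable def tau1M (_sys : LBSystem S N) : ℝ := S.μ 1 / S.μ S.M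

/-- `τ_{KM} = μ_K / μ_M`. -/
noncomputable def tauKM : ℝ := S.μ sys.K / S.μ S.M

/-! ### Assumptions -/

/-- Buffer-size assumption for the approximation parameter `ε`. -/
structure BufferSize (ε : ℝ) : Prop where
  eps_pos : 0 < ε
  eps_le : ε ≤ sys.betaHat / 4
  lower : 6 * Real.sqrt sys.tau1K ≤ (sys.b : ℝ)
  upper : sys.b ≤
    ⌊(ε ^ 2 * (N : ℝ) / (1152 * sys.tau1K * Real.log N)) ^ ((1 : ℝ) / 5)⌋₊

/-- Well-connectedness assumption for `ε` with parameters `d₁, d₂`. -/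
structure WellConnected (ε d₁ d₂ : ℝ) : Prop where
  first : ∀ I : Finset (Fin N), I ⊆ sys.R (sys.K - 1) →
    (N : ℝ) * (ε / (6 * (sys.b : ℝ) ^ 2)) ≤ (I.card : ℝ) → sys.D I ≤ N * d₁
  second : ∀ I : Finset (Fin N), I ⊆ sys.R sys.K →
    (N : ℝ) * (sys.betaHat / 2) ≤ (I.card : ℝ) → sys.D I ≤ N * d₂
  d₁_le : d₁ ≤ ε * S.μ sys.K / (12 * (sys.b : ℝ) ^ 3)
  d₂_le : d₂ ≤ ε * S.μ sys.K / (2 * (sys.b : ℝ))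

end LBSystem

/-!
The proof rests on a single Lyapunov function for the chain of queue lengths. Let `n` be the number
of busy servers in `R_K`, `X` the number of jobs waiting there, and `I` the number of idle servers
in `R_{K-1}`. The function is `F = X + φ(n) + ψ(I)` (`LBSystem.potential`, `LBSystem.lyapunov`),
where `φ` and `ψ` are smoothed versions of `(n - N * C^* - N * ε / 12)⁺` and
`(I - N * ε / (6 * b ^ 2))⁺`; their increments are the slopes `h` and `g` of `LBSystem.ramp`.

Both policies send a job to the idle servers of types at most `k` whenever its port is adjacent to
one of them (`LBSystem.candidates_subset_idleR`), so well-connectedness bounds the arrivals that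
miss these servers. The busy servers of `R_K` work at the total rate
`λ_Σ + μ_K * (n - N * C^*) - W`, where `W` is the rate in excess of `μ_K` that is lost through idle
servers of `R_{K-1}`. Hence, up to the smoothing error, the drift of `F` is at most
`h * (W - μ_K * (n - N * C^*)) + (1 - h) * (A - σ) + g * (δ - W - μ_K * I)`, with `A`, `δ` the
arrivals that miss the idle servers of `R_K`, `R_{K-1}` and `σ` the service rate of the servers
with waiting jobs. The terms serve different regimes: if `n` is large, the first one is negative; if
`n` is small, `A` is small and `σ` is at least `μ_K * X / b`; if `I` is large, the last one absorbs
`W`, and otherwise `W` is negligible because `b ^ 2 ≥ 36 * τ_{1K}`. So the drift is at most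
`-μ_K * N * ε / (8 * b)` in every state with `F ≥ 4 / 5 * N * ε`, without any exceptional set
(`drift_arith`, `LBSystem.lyapunov_drift`); the smoothing error is absorbed because `N * ε ^ 2` is
large compared with `b ^ 5`.

A quadratic test function of `F` turns this drift into the mean excess bound
(`sum_stationary_excess_le`, `LBSystem.expect_excess_le`), and an exponential one shows that fewer
than `N * β̂ / 2` servers of `R_K` are idle with probability at most `1 / N`
(`sum_stationary_tail_le`, `LBSystem.expect_overloaded_le`). Outside that event at most `N * d₂` of
the arrival rate misses the idle servers of `R_K`. This bounds the blocking probability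
(`LBSystem.blockProb_le`) and, by conservation of jobs, the number of jobs at the slower types
(`LBSystem.expect_slow_jobs_le`).
-/

/-! ### Drift bounds for stationary distributions of finite chains -/

section FiniteChain

variable {Q : Type*} [Fintype Q] {T : Q → Q → ℝ} {p : Q → ℝ}

/-- A stationary distribution annihilates the generator: every function has mean drift zero. -/
theorem sum_stationary_drift_eq_zero
    (hbal : ∀ q, p q * ∑ q', T q q' = ∑ q', p q' * T q' q) (f : Q → ℝ) :
    ∑ q, p q * ∑ q', T q q' * (f q' - f q) = 0 := by
  have h1 : ∑ q, p q * ∑ q', T q q' * (f q' - f q)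
      = ∑ q, ∑ q', p q * T q q' * f q' - ∑ q, (p q * ∑ q', T q q') * f q := by
    rw [← Finset.sum_sub_distrib]
    refine Finset.sum_congr rfl fun q _ => ?_
    rw [Finset.mul_sum, Finset.mul_sum, Finset.sum_mul, ← Finset.sum_sub_distrib]
    exact Finset.sum_congr rfl fun q' _ => by ring
  rw [h1, Finset.sum_comm, sub_eq_zero]
  refine Finset.sum_congr rfl fun q _ => ?_
  rw [hbal q, Finset.sum_mul]

theorem sum_mul_sub_mul (hp1 : ∑ q, p q = 1) (A B : ℝ) (x : Q → ℝ) :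
    ∑ q, p q * (A - B * x q) = A - B * ∑ q, p q * x q := by
  have h : ∀ q, p q * (A - B * x q) = p q * A - B * (p q * x q) := fun q => by ring
  simp only [h, Finset.sum_sub_distrib, ← Finset.sum_mul, ← Finset.mul_sum, hp1, one_mul]

/-- If `F` has jumps of size at most one and drift at most `-γ` above the level `c`, then the
quadratic test function `max (F - c) 0 ^ 2` bounds the stationary mean of the excess over `c`. -/
theorem sum_stationary_excess_le (hT : ∀ q q', 0 ≤ T q q') (hp : ∀ q, 0 ≤ p q)
    (hp1 : ∑ q, p q = 1) (hbal : ∀ q, p q * ∑ q', T q q' = ∑ q', p q' * T q' q)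
    {F : Q → ℝ} {c γ U : ℝ} (hγ : 0 < γ) (hU : ∀ q, ∑ q', T q q' ≤ U)
    (hjump : ∀ q q', T q q' ≠ 0 → |F q' - F q| ≤ 1)
    (hdrift : ∀ q, c ≤ F q → ∑ q', T q q' * (F q' - F q) ≤ -γ) :
    ∑ q, p q * max (F q - c) 0 ≤ U / (2 * γ) := by
  have key : ∀ q, ∑ q', T q q' * (max (F q' - c) 0 ^ 2 - max (F q - c) 0 ^ 2)
      ≤ U - 2 * γ * max (F q - c) 0 := by
    intro q
    have h1 : ∀ q', T q q' * (max (F q' - c) 0 ^ 2 - max (F q - c) 0 ^ 2)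
        ≤ T q q' + 2 * max (F q - c) 0 * (T q q' * (F q' - F q)) := by
      intro q'
      by_cases h0 : T q q' = 0
      · simp [h0]
      have hj := abs_le.1 (hjump q q' h0)
      have : max (F q' - c) 0 ^ 2 - max (F q - c) 0 ^ 2
          ≤ 1 + 2 * max (F q - c) 0 * (F q' - F q) := by
        rcases le_total (F q' - c) 0 with h | h <;> rcases le_total (F q - c) 0 with h' | h' <;>
          simp only [max_eq_left, max_eq_right, h, h'] <;> nlinarith
      calc _ ≤ T q q' * (1 + 2 * max (F q - c) 0 * (F q' - F q)) :=
            mul_le_mul_of_nonneg_left this (hT q q')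
        _ = _ := by ring
    have h2 : 2 * max (F q - c) 0 * ∑ q', T q q' * (F q' - F q)
        ≤ -(2 * γ * max (F q - c) 0) := by
      rcases le_total (F q - c) 0 with h | h
      · simp [max_eq_right h]
      · have := mul_le_mul_of_nonneg_left (hdrift q (by linarith)) h
        rw [max_eq_left h]; nlinarith
    calc _ ≤ ∑ q', (T q q' + 2 * max (F q - c) 0 * (T q q' * (F q' - F q))) :=
          Finset.sum_le_sum fun q' _ => h1 q'
      _ = ∑ q', T q q' + 2 * max (F q - c) 0 * ∑ q', T q q' * (F q' - F q) := by
          rw [Finset.sum_add_distrib, Finset.mul_sum]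
      _ ≤ _ := by linarith [hU q]
  have h3 := sum_stationary_drift_eq_zero hbal (fun q => max (F q - c) 0 ^ 2)
  have h4 : ∑ q, p q * (U - 2 * γ * max (F q - c) 0)
      = U - 2 * γ * ∑ q, p q * max (F q - c) 0 :=
    sum_mul_sub_mul hp1 _ _ _
  have h5 := Finset.sum_le_sum fun q (_ : q ∈ Finset.univ) =>
    mul_le_mul_of_nonneg_left (key q) (hp q)
  rw [le_div_iff₀ (by positivity)]
  linarith

/-- Under the same drift condition, the exponential test function `exp (κ * max (F - c) 0)` with
`κ = γ / (2 * U)` gives an exponential bound for the stationary tail of `F`. -/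
theorem sum_stationary_tail_le (hT : ∀ q q', 0 ≤ T q q') (hp : ∀ q, 0 ≤ p q)
    (hp1 : ∑ q, p q = 1) (hbal : ∀ q, p q * ∑ q', T q q' = ∑ q', p q' * T q' q)
    {F : Q → ℝ} {c γ U : ℝ} (hγ : 0 < γ) (hγU : γ ≤ 2 * U) (hU : ∀ q, ∑ q', T q q' ≤ U)
    (hjump : ∀ q q', T q q' ≠ 0 → |F q' - F q| ≤ 1)
    (hdrift : ∀ q, c ≤ F q → ∑ q', T q q' * (F q' - F q) ≤ -γ) {j : ℝ} (hj : 1 ≤ j) :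
    ∑ q, p q * (if c + j ≤ F q then 1 else 0)
      ≤ 36 * (U / γ) ^ 2 * Real.exp (-(γ / (2 * U) * j)) := by
  have hUpos : 0 < U := by linarith
  set κ := γ / (2 * U) with hκ
  have hκ0 : 0 < κ := by positivity
  have hκ1 : κ ≤ 1 := by rw [hκ, div_le_one (by positivity)]; exact hγU
  have hκU : κ * U = γ / 2 := by rw [hκ]; field_simp
  set f : Q → ℝ := fun q => Real.exp (κ * max (F q - c) 0) with hf
  have he2 : Real.exp 2 ≤ 9 := by
    have h := Real.exp_one_lt_d9
    have h' : Real.exp 2 = Real.exp 1 * Real.exp 1 := by rw [← Real.exp_add]; norm_num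
    rw [h']; nlinarith [Real.exp_pos 1]
  have key : ∀ q, ∑ q', T q q' * (f q' - f q)
      ≤ 9 * U - κ * γ / 2 * Real.exp (κ * j) * (if c + j ≤ F q then 1 else 0) := by
    intro q
    rcases lt_or_ge (F q - c) 1 with hx | hx
    · rw [if_neg (by linarith)]
      have h1 : ∀ q', T q q' * (f q' - f q) ≤ T q q' * 9 := by
        intro q'
        by_cases h0 : T q q' = 0
        · simp [h0]
        have hj' := abs_le.1 (hjump q q' h0)
        refine mul_le_mul_of_nonneg_left ?_ (hT q q')
        have : f q' ≤ Real.exp 2 := by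
          refine Real.exp_le_exp.2 ?_
          have : max (F q' - c) 0 ≤ 2 := max_le (by linarith) (by norm_num)
          nlinarith [le_max_right (F q' - c) 0]
        linarith [Real.exp_pos (κ * max (F q - c) 0)]
      calc _ ≤ ∑ q', T q q' * 9 := Finset.sum_le_sum fun q' _ => h1 q'
        _ = (∑ q', T q q') * 9 := by rw [Finset.sum_mul]
        _ ≤ _ := by linarith [hU q]
    · have hfq : f q = Real.exp (κ * (F q - c)) := by
        simp only [hf]; rw [max_eq_left (by linarith)]
      have h1 : ∀ q', T q q' * (f q' - f q)
          ≤ f q * κ * (T q q' * (F q' - F q)) + f q * κ ^ 2 * T q q' := by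
        intro q'
        by_cases h0 : T q q' = 0
        · simp [h0]
        have hj' := hjump q q' h0
        have hj2 := abs_le.1 hj'
        have hfq' : f q' = f q * Real.exp (κ * (F q' - F q)) := by
          rw [hfq, ← Real.exp_add]
          simp only [hf]; rw [max_eq_left (by linarith)]; ring_nf
        have habs : |κ * (F q' - F q)| ≤ 1 := by
          rw [abs_mul, abs_of_pos hκ0]
          nlinarith [abs_nonneg (F q' - F q)]
        have he := (abs_le.1 (Real.abs_exp_sub_one_sub_id_le habs)).2
        have hsq : (κ * (F q' - F q)) ^ 2 ≤ κ ^ 2 := by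
          rw [mul_pow]
          have : (F q' - F q) ^ 2 ≤ 1 := by nlinarith
          nlinarith [sq_nonneg κ]
        have : f q' - f q ≤ f q * (κ * (F q' - F q) + κ ^ 2) := by
          rw [hfq']
          have hpos : 0 < f q := Real.exp_pos _
          nlinarith
        calc _ ≤ T q q' * (f q * (κ * (F q' - F q) + κ ^ 2)) :=
              mul_le_mul_of_nonneg_left this (hT q q')
          _ = _ := by ring
      have hfpos : 0 < f q := Real.exp_pos _
      have h2 : ∑ q', T q q' * (f q' - f q) ≤ -(κ * γ / 2 * f q) := by
        calc _ ≤ ∑ q', (f q * κ * (T q q' * (F q' - F q)) + f q * κ ^ 2 * T q q') :=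
              Finset.sum_le_sum fun q' _ => h1 q'
          _ = f q * κ * ∑ q', T q q' * (F q' - F q) + f q * κ ^ 2 * ∑ q', T q q' := by
              rw [Finset.sum_add_distrib, Finset.mul_sum, Finset.mul_sum]
          _ ≤ f q * κ * (-γ) + f q * κ ^ 2 * U := by
              gcongr
              · exact hdrift q (by linarith)
              · exact hU q
          _ = f q * κ * (-γ) + f q * κ * (κ * U) := by ring
          _ = _ := by rw [hκU]; ring
      have h3 : Real.exp (κ * j) * (if c + j ≤ F q then 1 else 0) ≤ f q := by
        split_ifs with h
        · rw [mul_one, hfq]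
          exact Real.exp_le_exp.2 (mul_le_mul_of_nonneg_left (by linarith) hκ0.le)
        · rw [mul_zero]; exact hfpos.le
      have h4 := mul_le_mul_of_nonneg_left h3 (by positivity : 0 ≤ κ * γ / 2)
      rw [mul_assoc (κ * γ / 2)]
      linarith
  have h3 := sum_stationary_drift_eq_zero hbal f
  set S := ∑ q, p q * (if c + j ≤ F q then (1 : ℝ) else 0) with hS
  have h4 : ∑ q, p q * (9 * U - κ * γ / 2 * Real.exp (κ * j) * (if c + j ≤ F q then 1 else 0))
      = 9 * U - κ * γ / 2 * Real.exp (κ * j) * S :=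
    sum_mul_sub_mul hp1 _ _ _
  have h5 := Finset.sum_le_sum fun q (_ : q ∈ Finset.univ) =>
    mul_le_mul_of_nonneg_left (key q) (hp q)
  have h6 : κ * γ / 2 * Real.exp (κ * j) * S ≤ 9 * U := by linarith
  have h7 : κ * γ / 2 * 36 * (U / γ) ^ 2 = 9 * U := by rw [hκ]; field_simp; ring
  rw [← h7] at h6
  rw [Real.exp_neg, ← div_eq_mul_inv, le_div_iff₀ (Real.exp_pos _)]
  have h8 : 0 < κ * γ / 2 := by positivity
  refine le_of_mul_le_mul_left ?_ h8
  linarith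

end FiniteChain

namespace LBSystem

variable {S : ServerTypes} {N : ℕ} (sys : LBSystem S N)

/-! ### Routing -/

theorem serviceRate_pos (r : Fin N) : 0 < sys.serviceRate r := S.μ_pos _ (sys.serverType_mem r)

/-- Slower servers have larger types. -/
theorem serverType_le_of_serviceRate_le {r r' : Fin N}
    (h : sys.serviceRate r' ≤ sys.serviceRate r) : sys.serverType r ≤ sys.serverType r' := by
  by_contra hlt
  exact absurd (S.μ_strictAnti _ (sys.serverType_mem r') _ (sys.serverType_mem r) (not_le.1 hlt))
    (not_lt.2 h)

theorem fastest_nonempty {A : Finset (Fin N)} (hA : A.Nonempty) : (sys.fastest A).Nonempty := by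
  obtain ⟨r, hr, hmax⟩ := A.exists_max_image sys.serviceRate hA
  exact ⟨r, Finset.mem_filter.2 ⟨hr, hmax⟩⟩

theorem portNbrs_nonempty (l : Fin sys.L) : (sys.portNbrs l).Nonempty := by
  obtain ⟨r, hr⟩ := sys.port_connected l
  exact ⟨r, by simp [portNbrs, hr]⟩

theorem candidates_nonempty (P : Policy) (l : Fin sys.L) (q : sys.State) :
    (sys.candidates P l q).Nonempty := by
  cases P with
  | JFSQ =>
    refine sys.fastest_nonempty ?_
    obtain ⟨r, hr, hmin⟩ := (sys.portNbrs l).exists_min_image q (sys.portNbrs_nonempty l)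
    exact ⟨r, Finset.mem_filter.2 ⟨hr, hmin⟩⟩
  | JFIQ =>
    unfold candidates
    dsimp only
    split_ifs with h
    · exact sys.fastest_nonempty h
    · exact sys.portNbrs_nonempty l

theorem routeProb_nonneg (P : Policy) (l : Fin sys.L) (q : sys.State) (r : Fin N) :
    0 ≤ sys.routeProb P l q r := by
  unfold routeProb; split_ifs <;> positivity

theorem sum_routeProb (P : Policy) (l : Fin sys.L) (q : sys.State) :
    ∑ r, sys.routeProb P l q r = 1 := by
  have h : ((sys.candidates P l q).card : ℝ) ≠ 0 := by
    exact_mod_cast (Finset.card_pos.2 (sys.candidates_nonempty P l q)).ne'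
  simp only [routeProb, Finset.sum_ite_mem, Finset.univ_inter, Finset.sum_const, nsmul_eq_mul]
  field_simp

/-- The idle servers of types `1, …, k`. -/
def idleR (k : ℕ) (q : sys.State) : Finset (Fin N) :=
  Finset.univ.filter fun r => sys.serverType r ≤ k ∧ (q r : ℕ) = 0

/-- Both policies send a job that sees an idle server of type at most `k` to such a server. -/
theorem candidates_subset_idleR (P : Policy) {l : Fin sys.L} {q : sys.State} {k : ℕ} {r₀ : Fin N}
    (hr₀ : r₀ ∈ sys.portNbrs l) (hidle : r₀ ∈ sys.idleR k q) :
    sys.candidates P l q ⊆ sys.idleR k q := by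
  obtain ⟨ht, hq⟩ := (Finset.mem_filter.1 hidle).2
  intro r hr
  cases P with
  | JFSQ =>
    obtain ⟨hrs, hrf⟩ := Finset.mem_filter.1 hr
    have h0 : (q r : ℕ) = 0 := by
      have := (Finset.mem_filter.1 hrs).2 r₀ hr₀
      have : (q r : ℕ) ≤ q r₀ := this
      omega
    have hr₀s : r₀ ∈ sys.shortest l q := by
      refine Finset.mem_filter.2 ⟨hr₀, fun r' _ => ?_⟩
      change (q r₀ : ℕ) ≤ q r'
      omega
    exact Finset.mem_filter.2 ⟨Finset.mem_univ _,
      (sys.serverType_le_of_serviceRate_le (hrf r₀ hr₀s)).trans ht, h0⟩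
  | JFIQ =>
    have hr₀i : r₀ ∈ sys.idle l q := Finset.mem_filter.2 ⟨hr₀, hq⟩
    unfold candidates at hr
    dsimp only at hr
    rw [if_pos ⟨r₀, hr₀i⟩] at hr
    obtain ⟨hri, hrf⟩ := Finset.mem_filter.1 hr
    exact Finset.mem_filter.2 ⟨Finset.mem_univ _,
      (sys.serverType_le_of_serviceRate_le (hrf r₀ hr₀i)).trans ht, (Finset.mem_filter.1 hri).2⟩

/-- The rate at which jobs are routed to server `r` in state `q` (including jobs that are then
blocked). -/
noncomputable def arr (P : Policy) (q : sys.State) (r : Fin N) : ℝ :=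
  ∑ l, sys.rate l * sys.routeProb P l q r

theorem arr_nonneg (P : Policy) (q : sys.State) (r : Fin N) : 0 ≤ sys.arr P q r :=
  Finset.sum_nonneg fun l _ => mul_nonneg (sys.rate_nonneg l) (sys.routeProb_nonneg P l q r)

theorem sum_arr (P : Policy) (q : sys.State) : ∑ r, sys.arr P q r = sys.totalRate := by
  unfold arr totalRate
  rw [Finset.sum_comm]
  refine Finset.sum_congr rfl fun l _ => ?_
  rw [← Finset.mul_sum, sum_routeProb, mul_one]

theorem sum_arr_le (P : Policy) (q : sys.State) (A : Finset (Fin N)) :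
    ∑ r ∈ A, sys.arr P q r ≤ sys.totalRate := by
  rw [← sys.sum_arr P q]
  exact Finset.sum_le_sum_of_subset_of_nonneg (Finset.subset_univ _)
    fun r _ _ => sys.arr_nonneg P q r

theorem totalRate_nonneg : 0 ≤ sys.totalRate := Finset.sum_nonneg fun l _ => sys.rate_nonneg l

/-- Only the jobs at ports that are not adjacent to an idle server of type at most `k` can be
routed elsewhere than to the idle servers of types at most `k`. -/
theorem sum_arr_compl_idleR_le (P : Policy) (q : sys.State) (k : ℕ) :
    ∑ r ∈ (sys.idleR k q)ᶜ, sys.arr P q r ≤ sys.D (sys.idleR k q) := by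
  unfold arr D
  rw [Finset.sum_comm, ← Finset.sum_add_sum_compl (sys.setNbrs (sys.idleR k q))]
  have h1 : ∑ l ∈ sys.setNbrs (sys.idleR k q), ∑ r ∈ (sys.idleR k q)ᶜ,
      sys.rate l * sys.routeProb P l q r = 0 := by
    refine Finset.sum_eq_zero fun l hl => Finset.sum_eq_zero fun r hr => ?_
    obtain ⟨r₀, hr₀, hl⟩ := Finset.mem_biUnion.1 hl
    have hr₀' : r₀ ∈ sys.portNbrs l := by
      simpa [portNbrs, serverNbrs] using hl
    have : r ∉ sys.candidates P l q := fun h =>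
      (Finset.mem_compl.1 hr) (sys.candidates_subset_idleR P hr₀' hr₀ h)
    simp [routeProb, this]
  rw [h1, zero_add]
  refine Finset.sum_le_sum fun l _ => ?_
  rw [← Finset.mul_sum]
  refine mul_le_of_le_one_right (sys.rate_nonneg l) ?_
  rw [← sys.sum_routeProb P l q]
  exact Finset.sum_le_sum_of_subset_of_nonneg (Finset.subset_univ _)
    fun r _ _ => sys.routeProb_nonneg P l q r

/-! ### The generator -/

variable {sys} in
/-- The state after a job is routed to server `r`; it is `q` itself if that server is full. -/
def up (q : sys.State) (r : Fin N) : sys.State :=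
  Function.update q r ⟨min ((q r : ℕ) + 1) sys.b, by omega⟩

variable {sys} in
/-- The state after a service completion at server `r`; it is `q` itself if that server is idle. -/
def down (q : sys.State) (r : Fin N) : sys.State :=
  Function.update q r ⟨(q r : ℕ) - 1, by omega⟩

theorem addJob_iff_eq_up {q q' : sys.State} {r : Fin N} :
    sys.AddJob q q' r ↔ (q r : ℕ) < sys.b ∧ q' = up q r := by
  constructor
  · rintro ⟨h1, h2⟩
    have hlt : (q r : ℕ) < sys.b := by have := (q' r).isLt; omega
    refine ⟨hlt, funext fun r' => ?_⟩
    by_cases h : r' = r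
    · subst h
      refine Fin.ext ?_
      simp only [up, Function.update_self]
      omega
    · rw [h2 r' h, up, Function.update_of_ne h]
  · rintro ⟨hlt, rfl⟩
    refine ⟨?_, fun r' h => ?_⟩
    · simp only [up, Function.update_self]; omega
    · rw [up, Function.update_of_ne h]

theorem addJob_iff_eq_down {q q' : sys.State} {r : Fin N} :
    sys.AddJob q' q r ↔ 0 < (q r : ℕ) ∧ q' = down q r := by
  constructor
  · rintro ⟨h1, h2⟩
    refine ⟨by omega, funext fun r' => ?_⟩
    by_cases h : r' = r
    · subst h
      refine Fin.ext ?_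
      simp only [down, Function.update_self]
      omega
    · rw [← h2 r' h, down, Function.update_of_ne h]
  · rintro ⟨hlt, rfl⟩
    refine ⟨?_, fun r' h => ?_⟩
    · simp only [down, Function.update_self]; omega
    · rw [down, Function.update_of_ne h]

theorem up_eq_self {q : sys.State} {r : Fin N} (h : ¬ (q r : ℕ) < sys.b) : up q r = q := by
  unfold up
  rw [Function.update_eq_self_iff]
  refine Fin.ext ?_
  have := (q r).isLt
  dsimp only
  omega

theorem down_eq_self {q : sys.State} {r : Fin N} (h : ¬ 0 < (q r : ℕ)) : down q r = q := by
  unfold down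
  rw [Function.update_eq_self_iff]
  refine Fin.ext ?_
  dsimp only
  omega

open Classical in
theorem sum_transRate_mul (P : Policy) (q : sys.State) (f : sys.State → ℝ) :
    ∑ q', sys.transRate P q q' * f q'
      = ∑ r, sys.arr P q r * (if (q r : ℕ) < sys.b then f (up q r) else 0)
        + ∑ r, sys.serviceRate r * (if 0 < (q r : ℕ) then f (down q r) else 0) := by
  have hup : ∀ r, ∑ q', (if sys.AddJob q q' r then (1 : ℝ) else 0) * f q'
      = if (q r : ℕ) < sys.b then f (up q r) else 0 := by
    intro r
    simp only [addJob_iff_eq_up]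
    by_cases h : (q r : ℕ) < sys.b <;> simp [h]
  have hdown : ∀ r, ∑ q', (if sys.AddJob q' q r then (1 : ℝ) else 0) * f q'
      = if 0 < (q r : ℕ) then f (down q r) else 0 := by
    intro r
    simp only [addJob_iff_eq_down]
    by_cases h : 0 < (q r : ℕ) <;> simp [h]
  have hrate : ∀ q', (∑ l, sys.rate l * ∑ r, sys.routeProb P l q r *
      (if sys.AddJob q q' r then (1 : ℝ) else 0))
      = ∑ r, sys.arr P q r * (if sys.AddJob q q' r then 1 else 0) := by
    intro q'
    simp only [arr, Finset.mul_sum, Finset.sum_mul]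
    rw [Finset.sum_comm]
    exact Finset.sum_congr rfl fun r _ => Finset.sum_congr rfl fun l _ => by ring
  unfold transRate
  simp only [hrate, add_mul, Finset.sum_add_distrib, Finset.sum_mul]
  congr 1
  · rw [Finset.sum_comm]
    refine Finset.sum_congr rfl fun r _ => ?_
    rw [← hup r, Finset.mul_sum]
    exact Finset.sum_congr rfl fun q' _ => by ring
  · rw [Finset.sum_comm]
    refine Finset.sum_congr rfl fun r _ => ?_
    rw [← hdown r, Finset.mul_sum]
    exact Finset.sum_congr rfl fun q' _ => by ring

/-- The drift of `f`, server by server. -/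
theorem sum_transRate_mul_sub (P : Policy) (q : sys.State) (f : sys.State → ℝ) :
    ∑ q', sys.transRate P q q' * (f q' - f q)
      = ∑ r, sys.arr P q r * (f (up q r) - f q)
        + ∑ r, sys.serviceRate r * (f (down q r) - f q) := by
  rw [sys.sum_transRate_mul P q fun q' => f q' - f q]
  congr 1
  · refine Finset.sum_congr rfl fun r _ => ?_
    split_ifs with h
    · rfl
    · rw [sys.up_eq_self h, sub_self]
  · refine Finset.sum_congr rfl fun r _ => ?_
    split_ifs with h
    · rfl
    · rw [sys.down_eq_self h, sub_self]

theorem sum_transRate_le (P : Policy) (q : sys.State) :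
    ∑ q', sys.transRate P q q' ≤ sys.totalRate + ∑ r, sys.serviceRate r := by
  have h := sys.sum_transRate_mul P q fun _ => 1
  simp only [mul_one] at h
  rw [h, ← sys.sum_arr P q]
  gcongr with r _ r _
  · refine mul_le_of_le_one_right (sys.arr_nonneg P q r) ?_
    split_ifs <;> norm_num
  · refine mul_le_of_le_one_right (sys.serviceRate_pos r).le ?_
    split_ifs <;> norm_num

theorem transRate_nonneg (P : Policy) (q q' : sys.State) : 0 ≤ sys.transRate P q q' := by
  unfold transRate
  refine add_nonneg (Finset.sum_nonneg fun l _ => mul_nonneg (sys.rate_nonneg l)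
    (Finset.sum_nonneg fun r _ => mul_nonneg (sys.routeProb_nonneg P l q r) ?_))
    (Finset.sum_nonneg fun r _ => mul_nonneg (sys.serviceRate_pos r).le ?_) <;>
  split_ifs <;> norm_num

theorem exists_eq_up_or_down (P : Policy) {q q' : sys.State} (h : sys.transRate P q q' ≠ 0) :
    ∃ r, q' = up q r ∨ q' = down q r := by
  by_contra! hne
  have h1 : ∀ r, ¬ sys.AddJob q q' r := fun r hr => (hne r).1 (sys.addJob_iff_eq_up.1 hr).2
  have h2 : ∀ r, ¬ sys.AddJob q' q r := fun r hr => (hne r).2 (sys.addJob_iff_eq_down.1 hr).2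
  exact h (by simp [transRate, h1, h2])

/-! ### Parameters -/

theorem K_spec : sys.totalRate < (N : ℝ) * ∑ m ∈ Finset.Icc 1 sys.K, S.μ m * S.α m :=
  Nat.sInf_mem (s := {k : ℕ | sys.totalRate < (N : ℝ) * ∑ m ∈ Finset.Icc 1 k, S.μ m * S.α m})
    ⟨S.M, sys.capacity⟩

theorem K_le : sys.K ≤ S.M := Nat.sInf_le sys.capacity

theorem one_le_K : 1 ≤ sys.K := by
  by_contra h
  have h0 : sys.K = 0 := by omega
  have := sys.K_spec
  rw [h0] at this
  simp only [zero_lt_one, Finset.Icc_eq_empty_of_lt, Finset.sum_empty, mul_zero] at this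
  exact absurd this (not_lt.2 sys.totalRate_nonneg)

theorem le_totalRate :
    (N : ℝ) * ∑ m ∈ Finset.Icc 1 (sys.K - 1), S.μ m * S.α m ≤ sys.totalRate := by
  by_contra! h
  have : sys.K ≤ sys.K - 1 := Nat.sInf_le h
  have := sys.one_le_K
  omega

theorem sum_R (w : ℕ → ℝ) {k : ℕ} (hk : k ≤ S.M) :
    ∑ r ∈ sys.R k, w (sys.serverType r) = (N : ℝ) * ∑ m ∈ Finset.Icc 1 k, w m * S.α m := by
  have hmaps : ∀ r ∈ sys.R k, sys.serverType r ∈ Finset.Icc 1 k := fun r hr =>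
    Finset.mem_Icc.2 ⟨(Finset.mem_Icc.1 (sys.serverType_mem r)).1, (Finset.mem_filter.1 hr).2⟩
  rw [← Finset.sum_fiberwise_of_maps_to hmaps, Finset.mul_sum]
  refine Finset.sum_congr rfl fun m hm => ?_
  obtain ⟨h1, h2⟩ := Finset.mem_Icc.1 hm
  have hset : (sys.R k).filter (fun r => sys.serverType r = m)
      = Finset.univ.filter fun r => sys.serverType r = m := by
    ext r
    simp only [R, Finset.mem_filter, Finset.mem_univ, true_and, and_iff_right_iff_imp]
    omega
  rw [hset, Finset.sum_congr rfl (fun r hr => by rw [(Finset.mem_filter.1 hr).2]),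
    Finset.sum_const, nsmul_eq_mul, sys.serverType_card m (Finset.mem_Icc.2 ⟨h1, h2.trans hk⟩)]
  ring

theorem sum_serviceRate_R {k : ℕ} (hk : k ≤ S.M) :
    ∑ r ∈ sys.R k, sys.serviceRate r = (N : ℝ) * ∑ m ∈ Finset.Icc 1 k, S.μ m * S.α m :=
  sys.sum_R S.μ hk

theorem card_R {k : ℕ} (hk : k ≤ S.M) :
    ((sys.R k).card : ℝ) = (N : ℝ) * ∑ m ∈ Finset.Icc 1 k, S.α m := by
  simpa using sys.sum_R (fun _ => 1) hk

theorem K_mem : sys.K ∈ Finset.Icc 1 S.M := Finset.mem_Icc.2 ⟨sys.one_le_K, sys.K_le⟩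

theorem μ_K_pos : 0 < S.μ sys.K := S.μ_pos _ sys.K_mem

theorem μ_anti {m m' : ℕ} (hm : 1 ≤ m) (h : m ≤ m') (hm' : m' ≤ S.M) : S.μ m' ≤ S.μ m := by
  rcases h.eq_or_lt with rfl | h
  · exact le_rfl
  · exact (S.μ_strictAnti m (Finset.mem_Icc.2 ⟨hm, h.le.trans hm'⟩) m'
      (Finset.mem_Icc.2 ⟨hm.trans h.le, hm'⟩) h).le

theorem serviceRate_le (r : Fin N) : sys.serviceRate r ≤ S.μ 1 := by
  obtain ⟨h1, h2⟩ := Finset.mem_Icc.1 (sys.serverType_mem r)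
  exact μ_anti le_rfl h1 h2

theorem μ_K_le_serviceRate {r : Fin N} (h : sys.serverType r ≤ sys.K) :
    S.μ sys.K ≤ sys.serviceRate r :=
  μ_anti (Finset.mem_Icc.1 (sys.serverType_mem r)).1 h sys.K_le

theorem μ_M_le_serviceRate (r : Fin N) : S.μ S.M ≤ sys.serviceRate r := by
  obtain ⟨h1, h2⟩ := Finset.mem_Icc.1 (sys.serverType_mem r)
  exact μ_anti h1 h2 le_rfl

theorem μ_K_le_μ_one : S.μ sys.K ≤ S.μ 1 := μ_anti le_rfl sys.one_le_K sys.K_le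

theorem μ_one_pos (sys : LBSystem S N) : 0 < S.μ 1 := sys.μ_K_pos.trans_le sys.μ_K_le_μ_one

theorem N_pos (sys : LBSystem S N) : 0 < (N : ℝ) := by
  rcases (Nat.cast_nonneg N : (0 : ℝ) ≤ N).eq_or_lt with h | h
  · have := sys.K_spec
    rw [← h, zero_mul] at this
    exact absurd this (not_lt.2 sys.totalRate_nonneg)
  · exact h

theorem sum_serviceRate_le : ∑ r, sys.serviceRate r ≤ N * S.μ 1 := by
  calc _ ≤ ∑ _r : Fin N, S.μ 1 := Finset.sum_le_sum fun r _ => sys.serviceRate_le r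
    _ = _ := by simp

theorem totalRate_le : sys.totalRate ≤ N * S.μ 1 := by
  refine le_trans ?_ sys.sum_serviceRate_le
  have h := sys.sum_serviceRate_R le_rfl
  rw [← Finset.sum_le_sum_of_subset_of_nonneg (Finset.subset_univ (sys.R S.M))
    (fun r _ _ => (sys.serviceRate_pos r).le) |>.antisymm
    (Finset.sum_le_sum_of_subset_of_nonneg (fun r _ => Finset.mem_filter.2
      ⟨Finset.mem_univ _, (Finset.mem_Icc.1 (sys.serverType_mem r)).2⟩)
      fun r _ _ => (sys.serviceRate_pos r).le), h]
  exact sys.capacity.le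

theorem sum_α_pos : 0 < ∑ m ∈ Finset.Icc 1 sys.K, S.α m :=
  Finset.sum_pos (fun m hm => S.α_pos m (Finset.Icc_subset_Icc_right sys.K_le hm))
    ⟨1, Finset.mem_Icc.2 ⟨le_rfl, sys.one_le_K⟩⟩

theorem sum_α_le_one : ∑ m ∈ Finset.Icc 1 sys.K, S.α m ≤ 1 := by
  rw [← S.α_sum]
  exact Finset.sum_le_sum_of_subset_of_nonneg (Finset.Icc_subset_Icc_right sys.K_le)
    fun m hm _ => (S.α_pos m hm).le

theorem sum_μα_pos : 0 < ∑ m ∈ Finset.Icc 1 sys.K, S.μ m * S.α m :=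
  Finset.sum_pos (fun m hm => mul_pos (S.μ_pos m (Finset.Icc_subset_Icc_right sys.K_le hm))
    (S.α_pos m (Finset.Icc_subset_Icc_right sys.K_le hm)))
    ⟨1, Finset.mem_Icc.2 ⟨le_rfl, sys.one_le_K⟩⟩

theorem beta_nonneg : 0 ≤ sys.beta := by
  have h := mul_pos sys.N_pos sys.sum_μα_pos
  rw [beta, sub_nonneg, div_le_one h]
  exact sys.K_spec.le

theorem beta_le_one : sys.beta ≤ 1 := by
  rw [beta, sub_le_self_iff]
  exact div_nonneg sys.totalRate_nonneg (mul_pos sys.N_pos sys.sum_μα_pos).le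

theorem betaHat_le_sum_α : sys.betaHat ≤ ∑ m ∈ Finset.Icc 1 sys.K, S.α m :=
  mul_le_of_le_one_left sys.sum_α_pos.le sys.beta_le_one

theorem totalRate_eq : sys.totalRate
    = N * (∑ m ∈ Finset.Icc 1 sys.K, S.μ m * S.α m) * (1 - sys.beta) := by
  have h := mul_pos sys.N_pos sys.sum_μα_pos
  rw [beta, sub_sub_cancel, mul_div_cancel₀ _ h.ne']

theorem Icc_sub_one_eq : Finset.Icc 1 (sys.K - 1) = Finset.Ico 1 sys.K := by
  have := sys.one_le_K
  ext m
  simp only [Finset.mem_Icc, Finset.mem_Ico]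
  omega

theorem sum_Icc_K (w : ℕ → ℝ) : ∑ m ∈ Finset.Icc 1 sys.K, w m
    = ∑ m ∈ Finset.Icc 1 (sys.K - 1), w m + w sys.K := by
  obtain ⟨k, hk⟩ : ∃ k, sys.K = k + 1 := ⟨sys.K - 1, by have := sys.one_le_K; omega⟩
  rw [hk, Finset.sum_Icc_succ_top (by omega)]
  simp

theorem N_mul_Cstar : (N : ℝ) * sys.Cstar = (sys.R (sys.K - 1)).card
    + (sys.totalRate - ∑ r ∈ sys.R (sys.K - 1), sys.serviceRate r) / S.μ sys.K := by
  have hle : sys.K - 1 ≤ S.M := by have := sys.K_le; omega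
  have hN := sys.N_pos
  have h1 : ∑ m ∈ Finset.Icc 1 (sys.K - 1), sys.CstarOf m
      = ∑ m ∈ Finset.Icc 1 (sys.K - 1), S.α m := by
    refine Finset.sum_congr rfl fun m hm => ?_
    rw [sys.Icc_sub_one_eq] at hm
    rw [CstarOf, if_pos (Finset.mem_Ico.1 hm).2]
  rw [Cstar, sys.sum_Icc_K, h1, sys.card_R hle, sys.sum_serviceRate_R hle, CstarOf,
    if_neg (lt_irrefl _), lam, ← sys.Icc_sub_one_eq]
  field_simp

/-- The target level `C^*` leaves a proportion at least `β̂` of all servers idle in `R_K`. -/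
theorem N_mul_Cstar_le : (N : ℝ) * sys.Cstar ≤ (sys.R sys.K).card - N * sys.betaHat := by
  have hle : sys.K - 1 ≤ S.M := by have := sys.K_le; omega
  have hμ := sys.μ_K_pos
  rw [N_mul_Cstar, sys.card_R hle, sys.card_R sys.K_le, sys.sum_serviceRate_R hle, totalRate_eq,
    betaHat, sys.sum_Icc_K S.α, sys.sum_Icc_K fun m => S.μ m * S.α m]
  have hmono : S.μ sys.K * ∑ m ∈ Finset.Icc 1 (sys.K - 1), S.α m
      ≤ ∑ m ∈ Finset.Icc 1 (sys.K - 1), S.μ m * S.α m := by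
    rw [Finset.mul_sum]
    refine Finset.sum_le_sum fun m hm => ?_
    obtain ⟨h1, h2⟩ := Finset.mem_Icc.1 hm
    exact mul_le_mul_of_nonneg_right (μ_anti h1 (by omega) sys.K_le)
      (S.α_pos m (Finset.mem_Icc.2 ⟨h1, by omega⟩)).le
  have := mul_le_mul_of_nonneg_left hmono (mul_nonneg sys.N_pos.le sys.beta_nonneg)
  rw [← sub_nonneg]
  refine le_trans ?_ (le_of_eq (mul_div_cancel_left₀ _ hμ.ne'))
  refine div_nonneg ?_ hμ.le
  field_simp
  nlinarith

theorem one_le_tau1K : 1 ≤ sys.tau1K := by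
  rw [tau1K, one_le_div sys.μ_K_pos]; exact sys.μ_K_le_μ_one

variable {sys}

theorem BufferSize.eps_le_quarter {ε : ℝ} (h : sys.BufferSize ε) : ε ≤ 1 / 4 := by
  have := h.eps_le
  have := sys.betaHat_le_sum_α
  have := sys.sum_α_le_one
  linarith

theorem BufferSize.six_le_b {ε : ℝ} (h : sys.BufferSize ε) : (6 : ℝ) ≤ sys.b := by
  have h1 : 1 ≤ Real.sqrt sys.tau1K := Real.one_le_sqrt.2 sys.one_le_tau1K
  linarith [h.lower]

theorem BufferSize.tau1K_le {ε : ℝ} (h : sys.BufferSize ε) : 36 * sys.tau1K ≤ (sys.b : ℝ) ^ 2 := by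
  have h0 : 0 ≤ sys.tau1K := zero_le_one.trans sys.one_le_tau1K
  have h1 := Real.sq_sqrt h0
  have h2 := pow_le_pow_left₀ (by positivity) h.lower 2
  rw [mul_pow, h1] at h2
  linarith

theorem BufferSize.pow_le {ε : ℝ} (h : sys.BufferSize ε) (hN : 3 ≤ N) :
    1152 * sys.tau1K * (sys.b : ℝ) ^ 5 * Real.log N ≤ ε ^ 2 * N := by
  have hτ := sys.one_le_tau1K
  have hlog : 0 < Real.log N := Real.log_pos (by exact_mod_cast (by omega : 1 < N))
  have hx : 0 ≤ ε ^ 2 * (N : ℝ) / (1152 * sys.tau1K * Real.log N) := by positivity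
  have h1 := (Nat.le_floor_iff (Real.rpow_nonneg hx _)).1 h.upper
  have h2 := pow_le_pow_left₀ (Nat.cast_nonneg _) h1 5
  rw [← Real.rpow_natCast (_ ^ ((1 : ℝ) / 5)), ← Real.rpow_mul hx] at h2
  norm_num at h2
  rw [le_div_iff₀ (by positivity)] at h2
  linarith

/-! ### Ramps and soft excesses -/

/-- The slope that increases linearly from `0` at `a` to `1` at `a + d`. -/
noncomputable def ramp (a d : ℝ) (n : ℕ) : ℝ := max 0 (min 1 ((n - a) / d))

/-- A smoothed version of `max (n - a) 0`: the function on `ℕ` with increments `ramp a d`. -/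
noncomputable def softExcess (a d : ℝ) (n : ℕ) : ℝ := ∑ i ∈ Finset.range n, ramp a d i

section ramp

variable {a d : ℝ} {n : ℕ}

theorem ramp_nonneg : 0 ≤ ramp a d n := le_max_left _ _

theorem ramp_le_one : ramp a d n ≤ 1 := max_le zero_le_one (min_le_left _ _)

theorem ramp_eq_zero (hd : 0 < d) (h : (n : ℝ) ≤ a) : ramp a d n = 0 :=
  max_eq_left ((min_le_right _ _).trans (div_nonpos_of_nonpos_of_nonneg (by linarith) hd.le))

theorem ramp_eq_one (hd : 0 < d) (h : a + d ≤ n) : ramp a d n = 1 := by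
  have : 1 ≤ ((n : ℝ) - a) / d := (one_le_div hd).2 (by linarith)
  rw [ramp, min_eq_left this, max_eq_right zero_le_one]

theorem ramp_succ_le (hd : 0 < d) : ramp a d (n + 1) ≤ ramp a d n + 1 / d := by
  have h : ((n + 1 : ℕ) - a) / d = (n - a) / d + 1 / d := by push_cast; ring
  have hd' : 0 < 1 / d := by positivity
  rw [ramp, ramp, h]
  refine max_le (add_nonneg (le_max_left _ _) hd'.le) ?_
  refine le_trans ?_ (add_le_add_left (le_max_right _ _) _)
  rw [← min_add_add_right]
  exact min_le_min_right _ (by linarith)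

theorem ramp_le_pred (hd : 0 < d) : ramp a d n ≤ ramp a d (n - 1) + 1 / d := by
  cases n with
  | zero => have : 0 < 1 / d := by positivity
            simpa using this.le
  | succ n => exact ramp_succ_le hd

theorem softExcess_succ : softExcess a d (n + 1) = softExcess a d n + ramp a d n :=
  Finset.sum_range_succ _ _

theorem softExcess_nonneg : 0 ≤ softExcess a d n := Finset.sum_nonneg fun _ _ => ramp_nonneg

theorem le_softExcess (hd : 0 < d) (ha : 0 ≤ a) : n - a - d - 1 ≤ softExcess a d n := by
  induction n with
  | zero => simp only [softExcess, Finset.range_zero, Finset.sum_empty, Nat.cast_zero]; linarith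
  | succ n ih =>
    rcases le_total (a + d) n with h | h
    · rw [softExcess_succ, ramp_eq_one hd h]; push_cast; linarith
    · refine le_trans ?_ softExcess_nonneg
      push_cast; linarith

theorem softExcess_le (hd : 0 < d) : softExcess a d n ≤ max 0 (n - a) := by
  induction n with
  | zero => simp [softExcess]
  | succ n ih =>
    rw [softExcess_succ]
    rcases le_total (n : ℝ) a with h | h
    · rw [ramp_eq_zero hd h, add_zero]
      exact ih.trans (max_le_max le_rfl (by push_cast; linarith))
    · rw [max_eq_right (by linarith)] at ih
      refine le_trans ?_ (le_max_right _ _)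
      push_cast
      linarith [ramp_le_one (a := a) (d := d) (n := n)]

end ramp

/-! ### The potential function -/

variable (sys)

/-- Number of busy servers of types `1, …, k`. -/
def busyCount (k : ℕ) (q : sys.State) : ℕ :=
  (Finset.univ.filter fun r => sys.serverType r ≤ k ∧ 0 < (q r : ℕ)).card

/-- Number of jobs waiting (not in service) at servers of types `1, …, k`. -/
def waitingCount (k : ℕ) (q : sys.State) : ℕ :=
  ∑ r, if sys.serverType r ≤ k then (q r : ℕ) - 1 else 0

/-- The potential: waiting jobs at the types `1, …, K`, plus the smoothed excess over `a₁` of the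
number of busy servers of these types, plus the smoothed excess over `a₂` of the number of idle
servers of the types `1, …, K - 1`; the two excesses are smoothed on windows of lengths `d₁`
and `d₂`. -/
noncomputable def potential (a₁ d₁ a₂ d₂ : ℝ) (q : sys.State) : ℝ :=
  sys.waitingCount sys.K q + softExcess a₁ d₁ (sys.busyCount sys.K q)
    + softExcess a₂ d₂ (sys.idleR (sys.K - 1) q).card

theorem sum_update_add {b : ℕ} (w : Fin N → ℕ → ℕ) (q : Fin N → Fin (b + 1)) (r : Fin N)
    (v : Fin (b + 1)) :
    ∑ x, w x (Function.update q r v x) + w r (q r) = ∑ x, w x (q x) + w r v := by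
  have h1 := Finset.add_sum_erase _ (fun x => w x (Function.update q r v x)) (Finset.mem_univ r)
  have h2 := Finset.add_sum_erase _ (fun x => w x (q x)) (Finset.mem_univ r)
  have h3 : ∑ x ∈ Finset.univ.erase r, w x (Function.update q r v x)
      = ∑ x ∈ Finset.univ.erase r, w x (q x) := Finset.sum_congr rfl fun x hx => by
    rw [Function.update_of_ne (Finset.ne_of_mem_erase hx)]
  simp only [Function.update_self] at h1
  omega

theorem busyCount_update (k : ℕ) (q : sys.State) (r : Fin N) (v : Fin (sys.b + 1)) :
    sys.busyCount k (Function.update q r v)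
        + (if sys.serverType r ≤ k ∧ 0 < (q r : ℕ) then 1 else 0)
      = sys.busyCount k q + if sys.serverType r ≤ k ∧ 0 < (v : ℕ) then 1 else 0 := by
  simp only [busyCount, Finset.card_filter]
  exact sum_update_add (fun x n => if sys.serverType x ≤ k ∧ 0 < n then 1 else 0) q r v

theorem card_idleR_update (k : ℕ) (q : sys.State) (r : Fin N) (v : Fin (sys.b + 1)) :
    (sys.idleR k (Function.update q r v)).card
        + (if sys.serverType r ≤ k ∧ (q r : ℕ) = 0 then 1 else 0)
      = (sys.idleR k q).card + if sys.serverType r ≤ k ∧ (v : ℕ) = 0 then 1 else 0 := by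
  simp only [idleR, Finset.card_filter]
  exact sum_update_add (fun x n => if sys.serverType x ≤ k ∧ n = 0 then 1 else 0) q r v

theorem waitingCount_update (k : ℕ) (q : sys.State) (r : Fin N) (v : Fin (sys.b + 1)) :
    sys.waitingCount k (Function.update q r v)
        + (if sys.serverType r ≤ k then (q r : ℕ) - 1 else 0)
      = sys.waitingCount k q + if sys.serverType r ≤ k then (v : ℕ) - 1 else 0 :=
  sum_update_add (fun x n => if sys.serverType x ≤ k then n - 1 else 0) q r v

variable (a₁ d₁ a₂ d₂ : ℝ) (q : sys.State) (r : Fin N)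

theorem potential_up_sub (hb : 1 ≤ sys.b) :
    sys.potential a₁ d₁ a₂ d₂ (up q r) - sys.potential a₁ d₁ a₂ d₂ q
      = if sys.serverType r ≤ sys.K then
          if (q r : ℕ) = 0 then ramp a₁ d₁ (sys.busyCount sys.K q)
            - (if sys.serverType r ≤ sys.K - 1 then
                ramp a₂ d₂ ((sys.idleR (sys.K - 1) q).card - 1) else 0)
          else if (q r : ℕ) < sys.b then 1 else 0
        else 0 := by
  have h1 := sys.busyCount_update sys.K q r ⟨min ((q r : ℕ) + 1) sys.b, by omega⟩
  have h2 := sys.card_idleR_update (sys.K - 1) q r ⟨min ((q r : ℕ) + 1) sys.b, by omega⟩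
  have h3 := sys.waitingCount_update sys.K q r ⟨min ((q r : ℕ) + 1) sys.b, by omega⟩
  have hlt := (q r).isLt
  change sys.busyCount sys.K (up q r) + _ = _ at h1
  change (sys.idleR (sys.K - 1) (up q r)).card + _ = _ at h2
  change sys.waitingCount sys.K (up q r) + _ = _ at h3
  have hpos : 0 < min ((q r : ℕ) + 1) sys.b := by omega
  simp only [hpos, hpos.ne', and_true, and_false, if_false] at h1 h2 h3
  unfold potential
  by_cases hK : sys.serverType r ≤ sys.K
  · simp only [hK, true_and, if_true] at h1 h3 ⊢
    by_cases h0 : (q r : ℕ) = 0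
    · simp only [h0, lt_irrefl, if_false, if_true, and_true, add_zero] at h1 h2 h3 ⊢
      have h3' : sys.waitingCount sys.K (up q r) = sys.waitingCount sys.K q := by omega
      rw [h1, h3', softExcess_succ]
      by_cases hf : sys.serverType r ≤ sys.K - 1
      · simp only [hf, if_true] at h2 ⊢
        rw [← h2, softExcess_succ, Nat.add_sub_cancel]
        ring
      · simp only [hf, if_false, add_zero] at h2 ⊢
        rw [h2]
        ring
    · simp only [h0, Nat.pos_of_ne_zero h0, if_true, if_false, and_false, add_zero,
        add_left_inj] at h1 h2 h3 ⊢
      rw [h1, h2]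
      split_ifs with hlt'
      · have : sys.waitingCount sys.K (up q r) = sys.waitingCount sys.K q + 1 := by omega
        rw [this]; push_cast; ring
      · have : sys.waitingCount sys.K (up q r) = sys.waitingCount sys.K q := by omega
        rw [this]; ring
  · have hf : ¬ sys.serverType r ≤ sys.K - 1 := by omega
    simp only [hK, hf, false_and, if_false, add_zero] at h1 h2 h3 ⊢
    rw [h1, h2, h3, sub_self]

theorem potential_down_sub :
    sys.potential a₁ d₁ a₂ d₂ (down q r) - sys.potential a₁ d₁ a₂ d₂ q
      = if sys.serverType r ≤ sys.K then
          if (q r : ℕ) = 0 then 0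
          else if (q r : ℕ) = 1 then -ramp a₁ d₁ (sys.busyCount sys.K q - 1)
            + (if sys.serverType r ≤ sys.K - 1 then
                ramp a₂ d₂ (sys.idleR (sys.K - 1) q).card else 0)
          else -1
        else 0 := by
  have h1 := sys.busyCount_update sys.K q r ⟨(q r : ℕ) - 1, by omega⟩
  have h2 := sys.card_idleR_update (sys.K - 1) q r ⟨(q r : ℕ) - 1, by omega⟩
  have h3 := sys.waitingCount_update sys.K q r ⟨(q r : ℕ) - 1, by omega⟩
  change sys.busyCount sys.K (down q r) + _ = _ at h1
  change (sys.idleR (sys.K - 1) (down q r)).card + _ = _ at h2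
  change sys.waitingCount sys.K (down q r) + _ = _ at h3
  by_cases h0 : (q r : ℕ) = 0
  · rw [sys.down_eq_self (by omega), sub_self]; simp [h0]
  unfold potential
  by_cases hK : sys.serverType r ≤ sys.K
  · simp only [hK, h0, Nat.pos_of_ne_zero h0, true_and, if_true, if_false, and_false,
      add_zero] at h1 h2 h3 ⊢
    by_cases hq1 : (q r : ℕ) = 1
    · simp only [hq1, Nat.sub_self, lt_irrefl, if_false, if_true, and_true, add_zero] at h1 h2 h3 ⊢
      have h3' : sys.waitingCount sys.K (down q r) = sys.waitingCount sys.K q := by omega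
      rw [← h1, h3', softExcess_succ, Nat.add_sub_cancel]
      by_cases hf : sys.serverType r ≤ sys.K - 1
      · simp only [hf, if_true] at h2 ⊢
        rw [h2, softExcess_succ]
        ring
      · simp only [hf, if_false, add_zero] at h2 ⊢
        rw [h2]
        ring
    · have hp : 0 < (q r : ℕ) - 1 := by omega
      simp only [hq1, hp, hp.ne', if_true, if_false, and_false, add_zero, add_left_inj]
        at h1 h2 h3 ⊢
      rw [h1, h2]
      have : sys.waitingCount sys.K q = sys.waitingCount sys.K (down q r) + 1 := by omega
      rw [this]; push_cast; ring
  · have hf : ¬ sys.serverType r ≤ sys.K - 1 := by omega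
    simp only [hK, hf, false_and, if_false, add_zero] at h1 h2 h3 ⊢
    rw [h1, h2, h3, sub_self]

theorem abs_potential_up_sub_le (hb : 1 ≤ sys.b) :
    |sys.potential a₁ d₁ a₂ d₂ (up q r) - sys.potential a₁ d₁ a₂ d₂ q| ≤ 1 := by
  rw [sys.potential_up_sub a₁ d₁ a₂ d₂ q r hb, abs_le]
  have h1 := ramp_nonneg (a := a₁) (d := d₁) (n := sys.busyCount sys.K q)
  have h2 := ramp_le_one (a := a₁) (d := d₁) (n := sys.busyCount sys.K q)
  have h3 := ramp_nonneg (a := a₂) (d := d₂) (n := (sys.idleR (sys.K - 1) q).card - 1)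
  have h4 := ramp_le_one (a := a₂) (d := d₂) (n := (sys.idleR (sys.K - 1) q).card - 1)
  split_ifs <;> constructor <;> linarith

theorem abs_potential_down_sub_le :
    |sys.potential a₁ d₁ a₂ d₂ (down q r) - sys.potential a₁ d₁ a₂ d₂ q| ≤ 1 := by
  rw [sys.potential_down_sub a₁ d₁ a₂ d₂ q r, abs_le]
  have h1 := ramp_nonneg (a := a₁) (d := d₁) (n := sys.busyCount sys.K q - 1)
  have h2 := ramp_le_one (a := a₁) (d := d₁) (n := sys.busyCount sys.K q - 1)
  have h3 := ramp_nonneg (a := a₂) (d := d₂) (n := (sys.idleR (sys.K - 1) q).card)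
  have h4 := ramp_le_one (a := a₂) (d := d₂) (n := (sys.idleR (sys.K - 1) q).card)
  split_ifs <;> constructor <;> linarith

/-! ### The drift of the potential -/

/-- The busy servers of types `1, …, k`. -/
def busyR (k : ℕ) : Finset (Fin N) :=
  Finset.univ.filter fun r => sys.serverType r ≤ k ∧ 0 < (q r : ℕ)

/-- The servers of types `1, …, k` with at least one waiting job. -/
def queuedR (k : ℕ) : Finset (Fin N) :=
  Finset.univ.filter fun r => sys.serverType r ≤ k ∧ 2 ≤ (q r : ℕ)

theorem R_eq_idleR_union_busyR (k : ℕ) (f : Fin N → ℝ) :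
    ∑ r ∈ sys.R k, f r = ∑ r ∈ sys.idleR k q, f r + ∑ r ∈ sys.busyR q k, f r := by
  rw [← Finset.sum_filter_add_sum_filter_not (sys.R k) (fun r => (q r : ℕ) = 0)]
  congr 1 <;> refine Finset.sum_congr ?_ fun _ _ => rfl <;> ext r <;>
    simp [R, idleR, busyR, Nat.pos_iff_ne_zero]

theorem busyCount_eq_card (k : ℕ) : sys.busyCount k q = (sys.busyR q k).card := rfl

theorem card_idleR_add_busyCount (k : ℕ) :
    ((sys.idleR k q).card : ℝ) + sys.busyCount k q = (sys.R k).card := by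
  have h := sys.R_eq_idleR_union_busyR q k fun _ => 1
  simp only [Finset.sum_const, nsmul_eq_mul, mul_one] at h
  rw [h, busyCount_eq_card]

/-- Splits the drift of the potential into the contributions of the three terms; the smoothing
costs the last two summands. -/
theorem drift_potential_le (P : Policy) (hb : 1 ≤ sys.b) (hd₁ : 0 < d₁) (hd₂ : 0 < d₂)
    {h g : ℝ} (hh : h = ramp a₁ d₁ (sys.busyCount sys.K q))
    (hg : g = ramp a₂ d₂ (sys.idleR (sys.K - 1) q).card) :
    ∑ q', sys.transRate P q q'
        * (sys.potential a₁ d₁ a₂ d₂ q' - sys.potential a₁ d₁ a₂ d₂ q)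
      ≤ h * (sys.totalRate - ∑ r ∈ sys.busyR q sys.K, sys.serviceRate r)
        + (1 - h) * (∑ r ∈ (sys.idleR sys.K q)ᶜ, sys.arr P q r
            - ∑ r ∈ sys.queuedR q sys.K, sys.serviceRate r)
        + g * (∑ r ∈ sys.busyR q (sys.K - 1), sys.serviceRate r
            - ∑ r ∈ sys.idleR (sys.K - 1) q, sys.arr P q r)
        + N * S.μ 1 * (1 / d₁ + 1 / d₂) := by
  have hh0 : 0 ≤ h := hh ▸ ramp_nonneg
  have hh1 : h ≤ 1 := hh ▸ ramp_le_one
  have hg0 : 0 ≤ g := hg ▸ ramp_nonneg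
  have hg1 : g ≤ 1 := hg ▸ ramp_le_one
  have hhp : h ≤ ramp a₁ d₁ (sys.busyCount sys.K q - 1) + 1 / d₁ := hh ▸ ramp_le_pred hd₁
  have hgp : g ≤ ramp a₂ d₂ ((sys.idleR (sys.K - 1) q).card - 1) + 1 / d₂ := hg ▸ ramp_le_pred hd₂
  have hd₁' : 0 < 1 / d₁ := by positivity
  have hd₂' : 0 < 1 / d₂ := by positivity
  rw [sys.sum_transRate_mul_sub P q]
  have hup : ∑ r, sys.arr P q r
        * (sys.potential a₁ d₁ a₂ d₂ (up q r) - sys.potential a₁ d₁ a₂ d₂ q)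
      ≤ h * ∑ r ∈ sys.idleR sys.K q, sys.arr P q r + ∑ r ∈ (sys.idleR sys.K q)ᶜ, sys.arr P q r
        - (g - 1 / d₂) * ∑ r ∈ sys.idleR (sys.K - 1) q, sys.arr P q r := by
    have hpt : ∀ r, sys.arr P q r
          * (sys.potential a₁ d₁ a₂ d₂ (up q r) - sys.potential a₁ d₁ a₂ d₂ q)
        ≤ h * (if r ∈ sys.idleR sys.K q then sys.arr P q r else 0)
          + (if r ∈ (sys.idleR sys.K q)ᶜ then sys.arr P q r else 0)
          - (g - 1 / d₂) * (if r ∈ sys.idleR (sys.K - 1) q then sys.arr P q r else 0) := by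
      intro r
      rw [sys.potential_up_sub a₁ d₁ a₂ d₂ q r hb, ← hh]
      have hA := sys.arr_nonneg P q r
      generalize ramp a₂ d₂ ((sys.idleR (sys.K - 1) q).card - 1) = ρ at hgp ⊢
      simp only [idleR, Finset.mem_compl, Finset.mem_filter, Finset.mem_univ, true_and]
      by_cases h0 : (q r : ℕ) = 0
      · by_cases hf : sys.serverType r ≤ sys.K - 1
        · have hK : sys.serverType r ≤ sys.K := by omega
          simp only [h0, hf, hK, and_self, if_true, not_true, if_false]
          nlinarith
        · by_cases hK : sys.serverType r ≤ sys.K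
          · simp only [h0, hf, hK, and_self, false_and, if_true, not_true, if_false]
            nlinarith
          · simp [h0, hf, hK, hA]
      · simp only [h0, and_false, if_false, not_false_iff, if_true]
        split_ifs <;> nlinarith
    refine (Finset.sum_le_sum fun r _ => hpt r).trans (le_of_eq ?_)
    rw [Finset.sum_sub_distrib, Finset.sum_add_distrib, ← Finset.mul_sum, ← Finset.mul_sum]
    simp only [Finset.sum_ite_mem, Finset.univ_inter]
  have hdown : ∑ r, sys.serviceRate r
        * (sys.potential a₁ d₁ a₂ d₂ (down q r) - sys.potential a₁ d₁ a₂ d₂ q)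
      ≤ -((h - 1 / d₁) * ∑ r ∈ sys.busyR q sys.K, sys.serviceRate r)
        - (1 - h) * ∑ r ∈ sys.queuedR q sys.K, sys.serviceRate r
        + g * ∑ r ∈ sys.busyR q (sys.K - 1), sys.serviceRate r := by
    have hpt : ∀ r, sys.serviceRate r
          * (sys.potential a₁ d₁ a₂ d₂ (down q r) - sys.potential a₁ d₁ a₂ d₂ q)
        ≤ -((h - 1 / d₁) * (if r ∈ sys.busyR q sys.K then sys.serviceRate r else 0))
          - (1 - h) * (if r ∈ sys.queuedR q sys.K then sys.serviceRate r else 0)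
          + g * (if r ∈ sys.busyR q (sys.K - 1) then sys.serviceRate r else 0) := by
      intro r
      rw [sys.potential_down_sub a₁ d₁ a₂ d₂ q r, ← hg]
      have hA := sys.serviceRate_pos r
      simp only [busyR, queuedR, Finset.mem_filter, Finset.mem_univ, true_and]
      by_cases hK : sys.serverType r ≤ sys.K
      · rcases (by omega : (q r : ℕ) = 0 ∨ (q r : ℕ) = 1 ∨ 2 ≤ (q r : ℕ)) with h0 | h0 | h0
        · simp [h0]
        · by_cases hf : sys.serverType r ≤ sys.K - 1
          · simp only [h0, hf, hK, true_and, if_true, if_false, one_ne_zero, zero_lt_one,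
              Nat.not_ofNat_le_one]
            nlinarith
          · simp only [h0, hf, hK, true_and, false_and, if_true, if_false, one_ne_zero,
              zero_lt_one, Nat.not_ofNat_le_one]
            nlinarith
        · have h1 : ¬ (q r : ℕ) = 0 := by omega
          have h2 : ¬ (q r : ℕ) = 1 := by omega
          have h3 : 0 < (q r : ℕ) := by omega
          simp only [h0, h1, h2, h3, hK, and_true, if_true, if_false]
          have := mul_pos hA hd₁'
          have := mul_nonneg hg0 hA.le
          split_ifs <;> nlinarith
      · have hf : ¬ sys.serverType r ≤ sys.K - 1 := by omega
        simp [hK, hf]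
    refine (Finset.sum_le_sum fun r _ => hpt r).trans (le_of_eq ?_)
    rw [Finset.sum_add_distrib, Finset.sum_sub_distrib, Finset.sum_neg_distrib, ← Finset.mul_sum,
      ← Finset.mul_sum, ← Finset.mul_sum]
    simp only [Finset.sum_ite_mem, Finset.univ_inter]
  have hsplit := Finset.sum_add_sum_compl (sys.idleR sys.K q) (sys.arr P q)
  rw [sys.sum_arr] at hsplit
  have hb1 : ∑ r ∈ sys.busyR q sys.K, sys.serviceRate r ≤ N * S.μ 1 :=
    (Finset.sum_le_sum_of_subset_of_nonneg (Finset.subset_univ _)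
      fun r _ _ => (sys.serviceRate_pos r).le).trans sys.sum_serviceRate_le
  have hb2 := (sys.sum_arr_le P q (sys.idleR (sys.K - 1) q)).trans sys.totalRate_le
  have h5 := mul_le_mul_of_nonneg_right hb1 hd₁'.le
  have h6 := mul_le_mul_of_nonneg_right hb2 hd₂'.le
  have h7 : ∑ r ∈ sys.idleR sys.K q, sys.arr P q r
      = sys.totalRate - ∑ r ∈ (sys.idleR sys.K q)ᶜ, sys.arr P q r := by linarith
  rw [h7] at hup
  nlinarith

/-! ### Service rates of the busy servers -/

/-- The total service rate of the busy servers of `R_K` in terms of their number: it equals the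
arrival rate when their number is `N * C^*` and no server faster than type `K` is idle. -/
theorem sum_serviceRate_busyR :
    ∑ r ∈ sys.busyR q sys.K, sys.serviceRate r
      = sys.totalRate + S.μ sys.K * (sys.busyCount sys.K q - N * sys.Cstar)
        - ∑ r ∈ sys.idleR (sys.K - 1) q, (sys.serviceRate r - S.μ sys.K) := by
  have hμ := sys.μ_K_pos
  have hone := sys.one_le_K
  -- Servers of type exactly `K` contribute nothing to sums of `serviceRate - μ_K`.
  have hsub : ∀ (A B : Finset (Fin N)), B ⊆ A → (∀ r ∈ A, r ∉ B → sys.serverType r = sys.K) →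
      ∑ r ∈ A, (sys.serviceRate r - S.μ sys.K) = ∑ r ∈ B, (sys.serviceRate r - S.μ sys.K) := by
    intro A B hBA hty
    refine (Finset.sum_subset hBA fun r hA hB => ?_).symm
    rw [serviceRate, hty r hA hB, sub_self]
  have h1 := hsub (sys.busyR q sys.K) (sys.busyR q (sys.K - 1))
    (fun r hr => by
      simp only [busyR, Finset.mem_filter, Finset.mem_univ, true_and] at hr ⊢; omega)
    (fun r hr hr' => by
      simp only [busyR, Finset.mem_filter, Finset.mem_univ, true_and] at hr hr'; omega)
  have h2 := sys.R_eq_idleR_union_busyR q (sys.K - 1) fun r => sys.serviceRate r - S.μ sys.K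
  have h3 := sys.N_mul_Cstar
  have h4 : S.μ sys.K * (N * sys.Cstar) = S.μ sys.K * (sys.R (sys.K - 1)).card
      + (sys.totalRate - ∑ r ∈ sys.R (sys.K - 1), sys.serviceRate r) := by
    rw [h3]; field_simp
  rw [busyCount_eq_card]
  simp only [Finset.sum_sub_distrib, Finset.sum_const, nsmul_eq_mul] at h1 h2 ⊢
  nlinarith

theorem sum_serviceRate_busyR_pred_le :
    ∑ r ∈ sys.busyR q (sys.K - 1), sys.serviceRate r
      ≤ sys.totalRate - ∑ r ∈ sys.idleR (sys.K - 1) q, (sys.serviceRate r - S.μ sys.K)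
        - S.μ sys.K * (sys.idleR (sys.K - 1) q).card := by
  have h1 := sys.R_eq_idleR_union_busyR q (sys.K - 1) sys.serviceRate
  have h2 := sys.sum_serviceRate_R (k := sys.K - 1) (by have := sys.K_le; omega)
  have h3 := sys.le_totalRate
  simp only [Finset.sum_sub_distrib, Finset.sum_const, nsmul_eq_mul]
  nlinarith

theorem sum_idleR_nonneg :
    0 ≤ ∑ r ∈ sys.idleR (sys.K - 1) q, (sys.serviceRate r - S.μ sys.K) :=
  Finset.sum_nonneg fun r hr => sub_nonneg.2 <| sys.μ_K_le_serviceRate <| by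
    have := (Finset.mem_filter.1 hr).2.1
    omega

theorem sum_idleR_le :
    ∑ r ∈ sys.idleR (sys.K - 1) q, (sys.serviceRate r - S.μ sys.K)
      ≤ S.μ 1 * (sys.idleR (sys.K - 1) q).card := by
  rw [mul_comm, ← nsmul_eq_mul, ← Finset.sum_const]
  exact Finset.sum_le_sum fun r _ => by linarith [sys.serviceRate_le r, sys.μ_K_pos]

/-- A server with waiting jobs has at most `b` of them, so long queues keep servers busy. -/
theorem waitingCount_le :
    S.μ sys.K * sys.waitingCount sys.K q
      ≤ sys.b * ∑ r ∈ sys.queuedR q sys.K, sys.serviceRate r := by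
  rw [waitingCount, queuedR, Finset.sum_filter, Nat.cast_sum, Finset.mul_sum, Finset.mul_sum]
  refine Finset.sum_le_sum fun r _ => ?_
  have hlt := (q r).isLt
  by_cases hK : sys.serverType r ≤ sys.K
  · by_cases h2 : 2 ≤ (q r : ℕ)
    · simp only [hK, h2, and_self, if_true]
      rw [mul_comm]
      have : (((q r : ℕ) - 1 : ℕ) : ℝ) ≤ sys.b := by exact_mod_cast (by omega)
      exact mul_le_mul this (sys.μ_K_le_serviceRate hK) sys.μ_K_pos.le (Nat.cast_nonneg _)
    · have : (q r : ℕ) - 1 = 0 := by omega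
      simp [h2, this]
  · simp [hK]

end LBSystem

/-! ### Negative drift above the target level -/

/-- The arithmetic behind the negative drift. Here `E = N * ε`, `m = μ_K`, `m₁ = μ_1`, `u` is the
excess of busy servers of `R_K` over `N * C^*`, `X` the number of waiting jobs in `R_K`, `I` the
number of idle servers of `R_{K-1}`, `W` the service rate lost through them, `A` the rate of
arrivals that miss the idle servers of `R_K`, `σ` the service rate of the servers with waiting jobs
and `δ` the rate of arrivals that miss the idle servers of `R_{K-1}`. -/
theorem drift_arith {E b m m₁ h g u X I W A σ δ : ℝ} (hE : 0 < E) (hb : 6 ≤ b) (hm : 0 < m)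
    (hm₁ : 36 * m₁ ≤ b ^ 2 * m) (hh0 : 0 ≤ h) (hh1 : h ≤ 1) (hg0 : 0 ≤ g) (hg1 : g ≤ 1)
    (hI0 : 0 ≤ I) (hW0 : 0 ≤ W) (hW : W ≤ m₁ * I)
    (hI : 0 < g → E ≤ 6 * b ^ 2 * I) (hI' : g < 1 → 3 * b ^ 2 * I ≤ E)
    (hδ : 0 < g → 12 * b ^ 3 * δ ≤ E * m) (hu : 0 < h → E ≤ 12 * u)
    (hA : h < 1 → 2 * b * A ≤ E * m) (hσ : m * X ≤ b * σ) (hX : h < 1 → 7 * E ≤ 10 * (X + I)) :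
    h * (W - m * u) + (1 - h) * (A - σ) + g * (δ - W - m * I) ≤ -(m * E / (6 * b)) := by
  have hb0 : 0 < b := by linarith
  have hb2 : 36 ≤ b ^ 2 := by nlinarith
  have hmE : 0 < m * E := mul_pos hm hE
  obtain ⟨x, hx⟩ : ∃ x, x = m * E / (6 * b) := ⟨_, rfl⟩
  have hbx : b * x = m * E / 6 := by rw [hx]; field_simp
  have hx0 : 0 < x := hx ▸ by positivity
  have hx6 : 36 * x ≤ m * E := by nlinarith
  rw [← hx]
  have hδ' : 0 < g → 2 * b * δ ≤ m * I := fun hg => by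
    have h1 := hδ hg
    have h2 := mul_le_mul_of_nonneg_left (hI hg) hm.le
    have h3 : 6 * b ^ 2 * (2 * b * δ) ≤ 6 * b ^ 2 * (m * I) := by nlinarith
    exact le_of_mul_le_mul_left h3 (by positivity)
  have hmI : 0 ≤ m * I := mul_nonneg hm.le hI0
  have hδ'' : 0 < g → δ ≤ m * I := fun hg => by
    by_contra! hlt
    have := hδ' hg
    nlinarith
  rcases lt_or_ge g 1 with hglt | hgge
  · have h1 : W ≤ m * E / 108 := by
      have h2 : b ^ 2 * W ≤ b ^ 2 * (m * E / 108) := by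
        have h3 := hI' hglt
        have hm10 : 0 ≤ m₁ * I := hW0.trans hW
        rcases hI0.eq_or_lt with h0 | h0
        · rw [← h0, mul_zero] at hW
          have : W = 0 := le_antisymm hW hW0
          rw [this, mul_zero]; positivity
        · have hm1 : 0 ≤ m₁ := nonneg_of_mul_nonneg_left hm10 h0
          have h4 := mul_le_mul_of_nonneg_left h3 hm1
          have h5 := mul_le_mul_of_nonneg_right hm₁ hE.le
          have h6 := mul_le_mul_of_nonneg_left hW (sq_nonneg b)
          nlinarith
      exact le_of_mul_le_mul_left h2 (by positivity)
    have hI2 : I ≤ E / 108 := by nlinarith [hI' hglt]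
    have t1 : h * (W - m * u) ≤ h * (-x) := by
      rcases hh0.eq_or_lt with h0 | h0
      · simp [← h0]
      · refine mul_le_mul_of_nonneg_left ?_ hh0
        nlinarith [mul_le_mul_of_nonneg_left (hu h0) hm.le]
    have t2 : (1 - h) * (A - σ) ≤ (1 - h) * (-x) := by
      rcases hh1.eq_or_lt with h0 | h0
      · simp [h0]
      · refine mul_le_mul_of_nonneg_left ?_ (by linarith)
        have h3 := mul_le_mul_of_nonneg_left (hX h0) hm.le
        have h4 := mul_le_mul_of_nonneg_left hI2 hm.le
        have h5 : b * (A - σ) ≤ b * (-x) := by nlinarith [hA h0]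
        exact le_of_mul_le_mul_left h5 hb0
    have t3 : g * (δ - W - m * I) ≤ 0 := by
      rcases hg0.eq_or_lt with h0 | h0
      · simp [← h0]
      · exact mul_nonpos_of_nonneg_of_nonpos hg0 (by linarith [hδ'' h0])
    linarith
  · have hg : g = 1 := le_antisymm hg1 hgge
    have hgpos : 0 < g := by linarith
    have t1 : h * (-(m * u)) ≤ h * (-x) := by
      rcases hh0.eq_or_lt with h0 | h0
      · simp [← h0]
      · refine mul_le_mul_of_nonneg_left ?_ hh0
        nlinarith [mul_le_mul_of_nonneg_left (hu h0) hm.le]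
    have t2 : (1 - h) * (A - σ + (δ - m * I)) ≤ (1 - h) * (-x) := by
      rcases hh1.eq_or_lt with h0 | h0
      · simp [h0]
      · refine mul_le_mul_of_nonneg_left ?_ (by linarith)
        have h3 := mul_le_mul_of_nonneg_left (hX h0) hm.le
        have h5 : b * (A - σ + (δ - m * I)) ≤ b * (-x) := by nlinarith [hA h0, hδ' hgpos]
        exact le_of_mul_le_mul_left h5 hb0
    have t3 := mul_nonneg hh0 (sub_nonneg.2 (hδ'' hgpos))
    rw [hg]
    nlinarith

namespace LBSystem

variable {S : ServerTypes} {N : ℕ} {sys : LBSystem S N} {ε d₁ d₂ : ℝ}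

theorem BufferSize.pow_le' (h : sys.BufferSize ε) (hN : 3 ≤ N) :
    1152 * sys.tau1K * (sys.b : ℝ) ^ 5 ≤ ε ^ 2 * N := by
  have hτ := sys.one_le_tau1K
  have hN' : (3 : ℝ) ≤ N := by exact_mod_cast hN
  have hlog : 1 ≤ Real.log N := by
    rw [Real.le_log_iff_exp_le (by linarith)]
    linarith [Real.exp_one_lt_d9]
  refine le_trans ?_ (h.pow_le hN)
  exact le_mul_of_one_le_right (by positivity) hlog

theorem BufferSize.le_N_mul_eps (h : sys.BufferSize ε) (hN : 3 ≤ N) : 1152 ≤ N * ε := by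
  have h1 := h.pow_le' hN
  have hτ := sys.one_le_tau1K
  have h2 : 1 ≤ (sys.b : ℝ) ^ 5 := one_le_pow₀ (by linarith [h.six_le_b])
  have h3 : 1 ≤ sys.tau1K * (sys.b : ℝ) ^ 5 := one_le_mul_of_one_le_of_one_le hτ h2
  have h4 := h.eps_le_quarter
  have h5 := h.eps_pos
  have h6 : ε * ε ≤ ε * 1 := mul_le_mul_of_nonneg_left (by linarith) h5.le
  nlinarith [mul_le_mul_of_nonneg_right h6 (Nat.cast_nonneg N : (0 : ℝ) ≤ N)]

theorem D_nonneg (A : Finset (Fin N)) : 0 ≤ sys.D A := Finset.sum_nonneg fun l _ => sys.rate_nonneg l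

theorem idleR_subset_R (k : ℕ) (q : sys.State) : sys.idleR k q ⊆ sys.R k := fun r hr => by
  simp only [idleR, R, Finset.mem_filter] at hr ⊢
  exact ⟨hr.1, hr.2.1⟩

/-- The states in which fewer than `N * β̂ / 2` servers of types `1, …, K` are idle. -/
def Overloaded (q : sys.State) : Prop :=
  ((sys.idleR sys.K q).card : ℝ) < N * (sys.betaHat / 2)

theorem WellConnected.d₂_nonneg (hW : sys.WellConnected ε d₁ d₂) : 0 ≤ d₂ := by
  have hN := sys.N_pos
  have h1 := sys.betaHat_le_sum_α
  have h2 := hW.second (sys.R sys.K) subset_rfl (by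
    rw [sys.card_R sys.K_le]
    refine mul_le_mul_of_nonneg_left ?_ hN.le
    have := mul_nonneg sys.beta_nonneg sys.sum_α_pos.le
    change 0 ≤ sys.betaHat at this
    linarith)
  have h3 := D_nonneg (sys := sys) (sys.R sys.K)
  by_contra! hneg
  nlinarith

theorem WellConnected.sum_arr_compl_le (hW : sys.WellConnected ε d₁ d₂) (P : Policy)
    {q : sys.State} (hq : ¬ Overloaded q) :
    ∑ r ∈ (sys.idleR sys.K q)ᶜ, sys.arr P q r ≤ N * d₂ :=
  (sys.sum_arr_compl_idleR_le P q sys.K).trans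
    (hW.second _ (idleR_subset_R _ q) (not_lt.1 hq))

theorem le_busyCount_of_overloaded (hB : sys.BufferSize ε) {q : sys.State} (hq : Overloaded q) :
    N * sys.Cstar + 2 * (N * ε) ≤ sys.busyCount sys.K q := by
  have h1 := sys.card_idleR_add_busyCount q sys.K
  have h2 := sys.N_mul_Cstar_le
  have h3 := mul_le_mul_of_nonneg_left hB.eps_le sys.N_pos.le
  unfold Overloaded at hq
  linarith

variable (sys ε) in
/-- The potential with the levels and windows suited to the tolerance `ε`. -/
noncomputable def lyapunov (q : sys.State) : ℝ :=
  sys.potential (N * sys.Cstar + N * ε / 12) (N * ε / 12)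
    (N * (ε / (6 * (sys.b : ℝ) ^ 2))) (N * (ε / (6 * (sys.b : ℝ) ^ 2))) q

/-- The error due to the smoothing is of order `b ^ 2 * μ_1 / ε`, at most a quarter of the main
part of the drift. -/
theorem smoothing_error_le (hB : sys.BufferSize ε) (hN : 3 ≤ N) :
    N * S.μ 1 * (1 / (N * ε / 12) + 1 / (N * (ε / (6 * (sys.b : ℝ) ^ 2))))
      ≤ S.μ sys.K * (N * ε) / (24 * sys.b) := by
  have hb6 := hB.six_le_b
  have hb0 : (0 : ℝ) < sys.b := by linarith
  have hN0 := sys.N_pos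
  have hε := hB.eps_pos
  have hμ := sys.μ_K_pos
  have hμ1 := sys.μ_one_pos
  have h1 := hB.pow_le' hN
  rw [tau1K, ← mul_div_assoc, div_mul_eq_mul_div, div_le_iff₀ hμ] at h1
  have h2 : N * S.μ 1 * (1 / (N * ε / 12) + 1 / (N * (ε / (6 * (sys.b : ℝ) ^ 2))))
      = S.μ 1 * (12 + 6 * (sys.b : ℝ) ^ 2) / ε := by field_simp
  rw [h2, div_le_div_iff₀ hε (by positivity)]
  have h3 : 36 ≤ (sys.b : ℝ) ^ 2 := by nlinarith
  have h4 : 12 + 6 * (sys.b : ℝ) ^ 2 ≤ (sys.b : ℝ) ^ 4 := by nlinarith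
  have h6 : 0 ≤ S.μ 1 * (sys.b : ℝ) ^ 5 := by positivity
  calc S.μ 1 * (12 + 6 * (sys.b : ℝ) ^ 2) * (24 * sys.b)
      = S.μ 1 * (24 * sys.b) * (12 + 6 * (sys.b : ℝ) ^ 2) := by ring
    _ ≤ S.μ 1 * (24 * sys.b) * (sys.b : ℝ) ^ 4 := mul_le_mul_of_nonneg_left h4 (by positivity)
    _ = 24 * (S.μ 1 * (sys.b : ℝ) ^ 5) := by ring
    _ ≤ 1152 * S.μ 1 * (sys.b : ℝ) ^ 5 := by linarith
    _ ≤ ε ^ 2 * N * S.μ sys.K := h1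
    _ = S.μ sys.K * (N * ε) * ε := by ring

theorem lyapunov_drift (hB : sys.BufferSize ε) (hW : sys.WellConnected ε d₁ d₂) (hN : 3 ≤ N)
    (P : Policy) (q : sys.State) (hF : 4 / 5 * (N * ε) ≤ sys.lyapunov ε q) :
    ∑ q', sys.transRate P q q' * (sys.lyapunov ε q' - sys.lyapunov ε q)
      ≤ -(S.μ sys.K * (N * ε) / (8 * sys.b)) := by
  have hb6 := hB.six_le_b
  have hb0 : (0 : ℝ) < sys.b := by linarith
  have hb1 : 1 ≤ sys.b := by exact_mod_cast (by linarith : (1 : ℝ) ≤ sys.b)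
  have hN0 := sys.N_pos
  have hε := hB.eps_pos
  have hμ := sys.μ_K_pos
  have hμ1 := sys.μ_one_pos
  have hE : 0 < N * ε := mul_pos hN0 hε
  have hw1 : 0 < N * ε / 12 := by positivity
  have hw2 : 0 < N * (ε / (6 * (sys.b : ℝ) ^ 2)) := by positivity
  have hw2' : 6 * (sys.b : ℝ) ^ 2 * (N * (ε / (6 * (sys.b : ℝ) ^ 2))) = N * ε := by field_simp
  have hτ : 36 * S.μ 1 ≤ (sys.b : ℝ) ^ 2 * S.μ sys.K := by
    have h1 := hB.tau1K_le
    rw [tau1K, ← mul_div_assoc, div_le_iff₀ hμ] at h1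
    exact h1
  obtain ⟨h, hh⟩ : ∃ h, h = ramp (N * sys.Cstar + N * ε / 12) (N * ε / 12)
    (sys.busyCount sys.K q) := ⟨_, rfl⟩
  obtain ⟨g, hg⟩ : ∃ g, g = ramp (N * (ε / (6 * (sys.b : ℝ) ^ 2)))
    (N * (ε / (6 * (sys.b : ℝ) ^ 2))) (sys.idleR (sys.K - 1) q).card := ⟨_, rfl⟩
  have hdrift := sys.drift_potential_le _ _ _ _ q P hb1 hw1 hw2 hh hg
  have hsplit := Finset.sum_add_sum_compl (sys.idleR (sys.K - 1) q) (sys.arr P q)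
  rw [sys.sum_arr] at hsplit
  have hlt : h < 1 → (sys.busyCount sys.K q : ℝ) < N * sys.Cstar + N * ε / 6 := fun hlt => by
    by_contra! hge
    rw [hh, ramp_eq_one hw1 (by linarith)] at hlt
    exact lt_irrefl _ hlt
  have hgpos : 0 < g → N * (ε / (6 * (sys.b : ℝ) ^ 2)) < (sys.idleR (sys.K - 1) q).card :=
    fun hpos => by
      by_contra! hle
      rw [hg, ramp_eq_zero hw2 hle] at hpos
      exact lt_irrefl _ hpos
  have key := drift_arith (E := N * ε) (b := sys.b) (m := S.μ sys.K) (m₁ := S.μ 1) (h := h)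
    (g := g) (u := sys.busyCount sys.K q - N * sys.Cstar) (X := sys.waitingCount sys.K q)
    (I := (sys.idleR (sys.K - 1) q).card)
    (W := ∑ r ∈ sys.idleR (sys.K - 1) q, (sys.serviceRate r - S.μ sys.K))
    (A := ∑ r ∈ (sys.idleR sys.K q)ᶜ, sys.arr P q r)
    (σ := ∑ r ∈ sys.queuedR q sys.K, sys.serviceRate r)
    (δ := ∑ r ∈ (sys.idleR (sys.K - 1) q)ᶜ, sys.arr P q r)
    hE hb6 hμ hτ (hh ▸ ramp_nonneg) (hh ▸ ramp_le_one) (hg ▸ ramp_nonneg) (hg ▸ ramp_le_one)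
    (Nat.cast_nonneg _) (sys.sum_idleR_nonneg q) (sys.sum_idleR_le q)
    (fun hpos => by
      have := mul_le_mul_of_nonneg_left (hgpos hpos).le (by positivity : 0 ≤ 6 * (sys.b : ℝ) ^ 2)
      linarith)
    (fun hlt => by
      by_contra! hgt
      have h1 : 6 * (sys.b : ℝ) ^ 2 * (N * (ε / (6 * (sys.b : ℝ) ^ 2))
          + N * (ε / (6 * (sys.b : ℝ) ^ 2)))
          ≤ 6 * (sys.b : ℝ) ^ 2 * ((sys.idleR (sys.K - 1) q).card : ℝ) := by linarith
      rw [hg, ramp_eq_one hw2 (le_of_mul_le_mul_left h1 (by positivity))] at hlt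
      exact lt_irrefl _ hlt)
    (fun hpos => by
      have h1 := (sys.sum_arr_compl_idleR_le P q (sys.K - 1)).trans
        (hW.first _ (idleR_subset_R _ q) (hgpos hpos).le)
      have h2 := hW.d₁_le
      rw [le_div_iff₀ (by positivity)] at h2
      have h3 := mul_le_mul_of_nonneg_left h1 (by positivity : 0 ≤ 12 * (sys.b : ℝ) ^ 3)
      nlinarith [mul_le_mul_of_nonneg_left h2 hN0.le])
    (fun hpos => by
      by_contra! hlt'
      rw [hh, ramp_eq_zero hw1 (by linarith)] at hpos
      exact lt_irrefl _ hpos)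
    (fun hlt' => by
      have h0 : ¬ Overloaded q := fun ho => by
        linarith [le_busyCount_of_overloaded hB ho, hlt hlt']
      have h1 := hW.sum_arr_compl_le P h0
      have h2 := hW.d₂_le
      rw [le_div_iff₀ (by positivity)] at h2
      have h3 := mul_le_mul_of_nonneg_left h1 (by positivity : 0 ≤ 2 * (sys.b : ℝ))
      nlinarith [mul_le_mul_of_nonneg_left h2 hN0.le])
    (sys.waitingCount_le q)
    (fun hlt' => by
      have h1 := hlt hlt'
      have h2 := softExcess_le (a := N * sys.Cstar + N * ε / 12) hw1 (n := sys.busyCount sys.K q)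
      have h3 : max 0 ((sys.busyCount sys.K q : ℝ) - (N * sys.Cstar + N * ε / 12)) ≤ N * ε / 12 :=
        max_le hw1.le (by linarith)
      have h4 := softExcess_le (a := N * (ε / (6 * (sys.b : ℝ) ^ 2))) hw2
        (n := (sys.idleR (sys.K - 1) q).card)
      have h5 : max 0 (((sys.idleR (sys.K - 1) q).card : ℝ) - N * (ε / (6 * (sys.b : ℝ) ^ 2)))
          ≤ ((sys.idleR (sys.K - 1) q).card : ℝ) := max_le (Nat.cast_nonneg _) (by linarith)
      unfold lyapunov potential at hF
      linarith)
  have hbusy := sys.sum_serviceRate_busyR q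
  have hg0 : 0 ≤ g := hg ▸ ramp_nonneg
  have herr := smoothing_error_le hB hN
  have hfin : S.μ sys.K * (N * ε) / (8 * sys.b)
      = S.μ sys.K * (N * ε) / (6 * sys.b) - S.μ sys.K * (N * ε) / (24 * sys.b) := by
    field_simp; ring
  rw [hfin]
  change ∑ q', sys.transRate P q q' * (sys.lyapunov ε q' - sys.lyapunov ε q) ≤ _ at hdrift
  rw [hbusy] at hdrift
  have hδ : ∑ r ∈ (sys.idleR (sys.K - 1) q)ᶜ, sys.arr P q r
      = sys.totalRate - ∑ r ∈ sys.idleR (sys.K - 1) q, sys.arr P q r := by linarith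
  rw [hδ] at key
  have hexp : g * (∑ r ∈ sys.busyR q (sys.K - 1), sys.serviceRate r
            - ∑ r ∈ sys.idleR (sys.K - 1) q, sys.arr P q r)
      ≤ g * (sys.totalRate - ∑ r ∈ sys.idleR (sys.K - 1) q, sys.arr P q r
        - ∑ r ∈ sys.idleR (sys.K - 1) q, (sys.serviceRate r - S.μ sys.K)
        - S.μ sys.K * (sys.idleR (sys.K - 1) q).card) :=
    mul_le_mul_of_nonneg_left (by linarith [sys.sum_serviceRate_busyR_pred_le q]) hg0
  have hexp' : h * (sys.totalRate - (sys.totalRate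
        + S.μ sys.K * (sys.busyCount sys.K q - N * sys.Cstar)
        - ∑ r ∈ sys.idleR (sys.K - 1) q, (sys.serviceRate r - S.μ sys.K)))
      = h * (∑ r ∈ sys.idleR (sys.K - 1) q, (sys.serviceRate r - S.μ sys.K)
        - S.μ sys.K * (sys.busyCount sys.K q - N * sys.Cstar)) := by ring
  rw [hexp'] at hdrift
  linarith

theorem lyapunov_jump (hB : sys.BufferSize ε) (P : Policy) {q q' : sys.State}
    (h : sys.transRate P q q' ≠ 0) : |sys.lyapunov ε q' - sys.lyapunov ε q| ≤ 1 := by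
  have hb1 : 1 ≤ sys.b := by exact_mod_cast (by linarith [hB.six_le_b] : (1 : ℝ) ≤ sys.b)
  obtain ⟨r, rfl | rfl⟩ := sys.exists_eq_up_or_down P h
  · exact sys.abs_potential_up_sub_le _ _ _ _ q r hb1
  · exact sys.abs_potential_down_sub_le _ _ _ _ q r

theorem le_lyapunov (hB : sys.BufferSize ε) (hN : 3 ≤ N) (hC : 0 ≤ sys.Cstar) (q : sys.State) :
    sys.busyCount sys.K q + sys.waitingCount sys.K q - N * sys.Cstar - N * ε / 6 - 1
      ≤ sys.lyapunov ε q := by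
  have hE := hB.le_N_mul_eps hN
  have h1 := le_softExcess (a := N * sys.Cstar + N * ε / 12) (d := N * ε / 12)
    (n := sys.busyCount sys.K q) (by linarith)
    (by have := mul_nonneg sys.N_pos.le hC; linarith)
  have h2 := softExcess_nonneg (a := N * (ε / (6 * (sys.b : ℝ) ^ 2)))
    (d := N * (ε / (6 * (sys.b : ℝ) ^ 2))) (n := (sys.idleR (sys.K - 1) q).card)
  unfold lyapunov potential
  linarith

variable (sys) in
theorem Cstar_nonneg : 0 ≤ sys.Cstar := by
  have h1 := sys.N_mul_Cstar
  have h2 := sys.le_totalRate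
  rw [← sys.sum_serviceRate_R (by have := sys.K_le; omega)] at h2
  have h3 : 0 ≤ N * sys.Cstar := by
    rw [h1]
    exact add_nonneg (Nat.cast_nonneg _) (div_nonneg (by linarith) sys.μ_K_pos.le)
  exact nonneg_of_mul_nonneg_right h3 sys.N_pos

/-! ### Job counts -/

variable (sys) in
theorem N_mul_sum_C (k : ℕ) (q : sys.State) :
    N * ∑ m ∈ Finset.Icc 1 k, sys.C m q
      = ∑ r, if sys.serverType r ≤ k then ((q r : ℕ) : ℝ) else 0 := by
  have hN := sys.N_pos
  have hC : ∀ m, N * sys.C m q = ∑ r, if sys.serverType r = m then ((q r : ℕ) : ℝ) else 0 := by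
    intro m
    have hs : ∀ i, N * sys.s m i q
        = ∑ r, if i ≤ (q r : ℕ) ∧ sys.serverType r = m then (1 : ℝ) else 0 := by
      intro i
      rw [s, mul_div_cancel₀ _ hN.ne', Finset.card_filter]
      push_cast
      rfl
    rw [C, Finset.mul_sum, Finset.sum_congr rfl fun i _ => hs i, Finset.sum_comm]
    refine Finset.sum_congr rfl fun r _ => ?_
    by_cases hm : sys.serverType r = m
    · have hlt := (q r).isLt
      have hset : (Finset.Icc 1 sys.b).filter (fun i => i ≤ (q r : ℕ)) = Finset.Icc 1 (q r : ℕ) := by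
        ext i
        simp only [Finset.mem_filter, Finset.mem_Icc]
        omega
      simp [hm, hset]
    · simp [hm]
  rw [Finset.mul_sum, Finset.sum_congr rfl fun m _ => hC m, Finset.sum_comm]
  refine Finset.sum_congr rfl fun r _ => ?_
  rw [Finset.sum_ite_eq]
  have h1 := (Finset.mem_Icc.1 (sys.serverType_mem r)).1
  simp [h1]

theorem sum_jobs_eq (q : sys.State) :
    (∑ r, if sys.serverType r ≤ sys.K then ((q r : ℕ) : ℝ) else 0)
      = sys.busyCount sys.K q + sys.waitingCount sys.K q := by
  rw [busyCount, waitingCount, Finset.card_filter]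
  push_cast
  rw [← Finset.sum_add_distrib]
  refine Finset.sum_congr rfl fun r _ => ?_
  by_cases hK : sys.serverType r ≤ sys.K
  · rcases Nat.eq_zero_or_pos (q r : ℕ) with h0 | h0
    · simp [h0]
    · simp only [hK, h0, and_self, if_true]
      rw [Nat.cast_sub h0]
      push_cast
      ring
  · simp [hK]

/-! ### Stationary bounds -/

variable {P : Policy} {p : sys.State → ℝ}

theorem expect_le_expect (hp : sys.IsStationary P p) {f g : sys.State → ℝ} (h : ∀ q, f q ≤ g q) :
    sys.expect p f ≤ sys.expect p g :=
  Finset.sum_le_sum fun q _ => mul_le_mul_of_nonneg_left (h q) (hp.nonneg q)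

theorem expect_const_add_mul (hp : sys.IsStationary P p) (A B : ℝ) (f : sys.State → ℝ) :
    sys.expect p (fun q => A + B * f q) = A + B * sys.expect p f := by
  have h := sum_mul_sub_mul hp.sum_eq_one A (-B) f
  simp only [neg_mul, sub_neg_eq_add] at h
  exact h

theorem expect_add (f g : sys.State → ℝ) :
    sys.expect p (fun q => f q + g q) = sys.expect p f + sys.expect p g := by
  simp only [expect, mul_add, Finset.sum_add_distrib]

variable (sys) in
theorem sum_transRate_le_two_mul (P : Policy) (q : sys.State) :
    ∑ q', sys.transRate P q q' ≤ 2 * (N * S.μ 1) := by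
  linarith [sys.sum_transRate_le P q, sys.totalRate_le, sys.sum_serviceRate_le]

theorem BufferSize.drift_pos (hB : sys.BufferSize ε) :
    0 < S.μ sys.K * (N * ε) / (8 * sys.b) := by
  have := sys.μ_K_pos
  have := sys.N_pos
  have := hB.eps_pos
  have := hB.six_le_b
  positivity

theorem expect_excess_le (hB : sys.BufferSize ε) (hW : sys.WellConnected ε d₁ d₂) (hN : 3 ≤ N)
    (hp : sys.IsStationary P p) :
    sys.expect p (fun q => max (∑ m ∈ Finset.Icc 1 sys.K, sys.C m q - (sys.Cstar + ε)) 0)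
      ≤ 8 * sys.b * sys.tau1K / (ε * N) := by
  have hN0 := sys.N_pos
  have hε := hB.eps_pos
  have hμ := sys.μ_K_pos
  have hb6 := hB.six_le_b
  have hE := hB.le_N_mul_eps hN
  have h1 := sum_stationary_excess_le (sys.transRate_nonneg P) hp.nonneg hp.sum_eq_one hp.balance
    hB.drift_pos (sys.sum_transRate_le_two_mul P) (fun q q' => lyapunov_jump hB P)
    (lyapunov_drift hB hW hN P)
  have h2 : ∀ q, max (∑ m ∈ Finset.Icc 1 sys.K, sys.C m q - (sys.Cstar + ε)) 0
      ≤ 0 + 1 / N * max (sys.lyapunov ε q - 4 / 5 * (N * ε)) 0 := by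
    intro q
    rw [zero_add, one_div, ← div_eq_inv_mul, le_div_iff₀ hN0, max_mul_of_nonneg _ _ hN0.le, zero_mul]
    refine max_le_max ?_ le_rfl
    have h3 := sys.N_mul_sum_C sys.K q
    rw [sum_jobs_eq] at h3
    have h4 := le_lyapunov hB hN sys.Cstar_nonneg q
    rw [sub_mul, mul_comm _ (N : ℝ), h3]
    linarith
  refine (expect_le_expect hp h2).trans ?_
  rw [expect_const_add_mul hp, zero_add]
  refine (mul_le_mul_of_nonneg_left h1 (by positivity)).trans (le_of_eq ?_)
  rw [tau1K]
  field_simp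

open Classical in
/-- Overload, which by `le_busyCount_of_overloaded` forces the Lyapunov function far above the
level where its drift is negative, has a stationary probability that decays exponentially in
`N * ε ^ 2`. -/
theorem expect_overloaded_le (hB : sys.BufferSize ε) (hW : sys.WellConnected ε d₁ d₂) (hN : 3 ≤ N)
    (hp : sys.IsStationary P p) :
    sys.expect p (fun q => if Overloaded q then 1 else 0) ≤ 1 / N := by
  have hN0 := sys.N_pos
  have hN3 : (3 : ℝ) ≤ N := by exact_mod_cast hN
  have hε := hB.eps_pos
  have hμ := sys.μ_K_pos
  have hμ1 := sys.μ_one_pos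
  have hb6 := hB.six_le_b
  have hb0 : (0 : ℝ) < sys.b := by linarith
  have hE := hB.le_N_mul_eps hN
  have hε4 := hB.eps_le_quarter
  have hτ1 := sys.one_le_tau1K
  have hpow := hB.pow_le hN
  have hpow' := hB.pow_le' hN
  have hlog : 0 ≤ Real.log N := Real.log_nonneg (by linarith)
  have hγU : S.μ sys.K * (N * ε) / (8 * sys.b) ≤ 2 * (2 * (N * S.μ 1)) := by
    rw [div_le_iff₀ (by positivity)]
    have h1 : S.μ sys.K * (N * ε) ≤ S.μ 1 * (N * 1) :=
      mul_le_mul sys.μ_K_le_μ_one (mul_le_mul_of_nonneg_left (by linarith) hN0.le)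
        (by positivity) hμ1.le
    have h2 : 0 < N * S.μ 1 := by positivity
    nlinarith
  have h1 := sum_stationary_tail_le (sys.transRate_nonneg P) hp.nonneg hp.sum_eq_one hp.balance
    hB.drift_pos hγU (sys.sum_transRate_le_two_mul P) (fun q q' => lyapunov_jump hB P)
    (lyapunov_drift hB hW hN P) (j := N * ε) (by linarith)
  have h2 : sys.expect p (fun q => if Overloaded q then 1 else 0)
      ≤ sys.expect p (fun q => if 4 / 5 * (N * ε) + N * ε ≤ sys.lyapunov ε q then 1 else 0) := by
    refine expect_le_expect hp fun q => ?_
    by_cases ho : Overloaded q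
    · have h3 := le_busyCount_of_overloaded hB ho
      have h4 := le_lyapunov hB hN sys.Cstar_nonneg q
      have h5 : (0 : ℝ) ≤ sys.waitingCount sys.K q := Nat.cast_nonneg _
      rw [if_pos ho, if_pos (by linarith)]
    · rw [if_neg ho]
      split_ifs <;> norm_num
  refine (h2.trans h1).trans ?_
  have hratio : 2 * (N * S.μ 1) / (S.μ sys.K * (N * ε) / (8 * sys.b))
      = 16 * (sys.b * sys.tau1K) / ε := by rw [tau1K]; field_simp; norm_num
  have hexp : S.μ sys.K * (N * ε) / (8 * sys.b) / (2 * (2 * (N * S.μ 1))) * (N * ε)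
      = ε ^ 2 * N / (32 * sys.b * sys.tau1K) := by rw [tau1K]; field_simp; norm_num
  have hb4 : (sys.b : ℝ) ≤ (sys.b : ℝ) ^ 5 := le_self_pow₀ (by linarith) (by norm_num)
  have hle : 4 * Real.log N ≤ ε ^ 2 * N / (32 * sys.b * sys.tau1K) := by
    rw [le_div_iff₀ (by positivity)]
    have h3 : 0 ≤ sys.tau1K * Real.log N := by positivity
    have h4 := mul_le_mul_of_nonneg_left hb4 h3
    have h5 : 0 ≤ sys.tau1K * Real.log N * sys.b := by positivity
    nlinarith
  have hexp4 : Real.exp (-(4 * Real.log N)) = ((N : ℝ) ^ 4)⁻¹ := by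
    rw [Real.exp_neg, mul_comm, Real.exp_mul, Real.exp_log hN0]
    norm_cast
  rw [hratio, hexp]
  have hbτ : sys.b * sys.tau1K ≤ ε ^ 2 * N / 1152 := by
    nlinarith [mul_le_mul_of_nonneg_left hb4 (by linarith : 0 ≤ sys.tau1K)]
  calc 36 * (16 * (sys.b * sys.tau1K) / ε) ^ 2
        * Real.exp (-(ε ^ 2 * N / (32 * sys.b * sys.tau1K)))
      ≤ 36 * (16 * (ε ^ 2 * N / 1152) / ε) ^ 2 * Real.exp (-(4 * Real.log N)) := by
        gcongr
    _ = ε ^ 2 / 144 / N ^ 2 := by rw [hexp4]; field_simp; norm_num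
    _ ≤ 1 / N := by
        rw [div_le_div_iff₀ (by positivity) hN0]
        nlinarith

open Classical in
/-- A job can only be blocked if it misses the idle servers of `R_K`. -/
theorem blockProb_le (hB : sys.BufferSize ε) (hW : sys.WellConnected ε d₁ d₂) (hN : 3 ≤ N)
    (hp : sys.IsStationary P p) (hlam : 0 < sys.lam) :
    sys.blockProb P p ≤ d₂ / sys.lam + 1 / N := by
  have hN0 := sys.N_pos
  have hb6 := hB.six_le_b
  have hΛ : 0 < sys.totalRate := by
    rw [lam] at hlam
    exact (div_pos_iff_of_pos_right hN0).1 hlam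
  have h1 : sys.blockProb P p = 1 / sys.totalRate
      * sys.expect p (fun q => ∑ r, sys.arr P q r * (if (q r : ℕ) = sys.b then 1 else 0)) := by
    simp only [blockProb, expect, arr, Finset.mul_sum, Finset.sum_mul]
    rw [Finset.sum_comm]
    refine Finset.sum_congr rfl fun q _ => ?_
    rw [Finset.sum_comm]
    refine Finset.sum_congr rfl fun r _ => Finset.sum_congr rfl fun l _ => ?_
    ring
  have h2 : ∀ q, ∑ r, sys.arr P q r * (if (q r : ℕ) = sys.b then 1 else 0)
      ≤ N * d₂ + sys.totalRate * (if Overloaded q then 1 else 0) := by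
    intro q
    have hle : ∑ r, sys.arr P q r * (if (q r : ℕ) = sys.b then 1 else 0)
        ≤ ∑ r ∈ (sys.idleR sys.K q)ᶜ, sys.arr P q r := by
      simp only [mul_ite, mul_one, mul_zero]
      rw [← Finset.sum_filter]
      refine Finset.sum_le_sum_of_subset_of_nonneg (fun r hr => ?_)
        fun r _ _ => sys.arr_nonneg P q r
      have hb : 6 ≤ sys.b := by exact_mod_cast hb6
      simp only [idleR, Finset.mem_compl, Finset.mem_filter, Finset.mem_univ, true_and] at hr ⊢
      omega
    by_cases ho : Overloaded q
    · have := hle.trans (sys.sum_arr_le P q _)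
      have := mul_nonneg hN0.le hW.d₂_nonneg
      rw [if_pos ho]
      linarith
    · rw [if_neg ho]
      linarith [hW.sum_arr_compl_le P ho]
  have h3 := expect_le_expect hp h2
  rw [expect_const_add_mul hp] at h3
  have h4 := mul_le_mul_of_nonneg_left (expect_overloaded_le hB hW hN hp) hΛ.le
  rw [h1]
  calc _ ≤ 1 / sys.totalRate * (N * d₂ + sys.totalRate * (1 / N)) := by
        gcongr
        linarith
    _ = _ := by rw [lam]; field_simp

open Classical in
/-- The jobs at the types slower than `K`: their servers have to work off what misses the idle
servers of `R_K`, and hold at most `b` jobs for each busy server. -/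
theorem expect_slow_jobs_le (hB : sys.BufferSize ε) (hW : sys.WellConnected ε d₁ d₂) (hN : 3 ≤ N)
    (hp : sys.IsStationary P p) :
    sys.expect p (fun q => ∑ r, if sys.serverType r ≤ sys.K then 0 else ((q r : ℕ) : ℝ))
      ≤ sys.b / S.μ S.M * (N * d₂ + sys.totalRate * (1 / N)) := by
  have hN0 := sys.N_pos
  have hμM : 0 < S.μ S.M := S.μ_pos _ (Finset.mem_Icc.2 ⟨sys.one_le_K.trans sys.K_le, le_rfl⟩)
  have hb0 : (0 : ℝ) < sys.b := by linarith [hB.six_le_b]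
  have hupdate : ∀ (q : sys.State) r v,
      (∑ x, if sys.serverType x ≤ sys.K then 0 else ((Function.update q r v x : ℕ) : ℝ))
        - (∑ x, if sys.serverType x ≤ sys.K then 0 else ((q x : ℕ) : ℝ))
        = if sys.serverType r ≤ sys.K then 0 else ((v : ℕ) : ℝ) - (q r : ℕ) := by
    intro q r v
    have h := sum_update_add (fun x n => if sys.serverType x ≤ sys.K then 0 else n) q r v
    have h' : ((∑ x, if sys.serverType x ≤ sys.K then 0 else (Function.update q r v x : ℕ) : ℕ) : ℝ)
        + ((if sys.serverType r ≤ sys.K then 0 else (q r : ℕ) : ℕ) : ℝ)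
        = ((∑ x, if sys.serverType x ≤ sys.K then 0 else (q x : ℕ) : ℕ) : ℝ)
        + ((if sys.serverType r ≤ sys.K then 0 else (v : ℕ) : ℕ) : ℝ) := by exact_mod_cast h
    push_cast at h'
    split_ifs at h' ⊢ <;> linarith
  have hdrift : ∀ q : sys.State, ∑ q', sys.transRate P q q'
        * ((∑ r, if sys.serverType r ≤ sys.K then 0 else ((q' r : ℕ) : ℝ))
          - ∑ r, if sys.serverType r ≤ sys.K then 0 else ((q r : ℕ) : ℝ))
      ≤ (N * d₂ + sys.totalRate * (if Overloaded q then 1 else 0))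
        + -(S.μ S.M / sys.b) * ∑ r, if sys.serverType r ≤ sys.K then 0 else ((q r : ℕ) : ℝ) := by
    intro q
    rw [sys.sum_transRate_mul_sub P q
      fun q => ∑ r, if sys.serverType r ≤ sys.K then 0 else ((q r : ℕ) : ℝ)]
    refine add_le_add ?_ ?_
    · have h1 : ∀ r, sys.arr P q r
          * ((∑ x, if sys.serverType x ≤ sys.K then 0 else ((up q r x : ℕ) : ℝ))
            - ∑ x, if sys.serverType x ≤ sys.K then 0 else ((q x : ℕ) : ℝ))
          ≤ if r ∈ (sys.idleR sys.K q)ᶜ then sys.arr P q r else 0 := by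
        intro r
        have hA := sys.arr_nonneg P q r
        rw [up, hupdate]
        by_cases hK : sys.serverType r ≤ sys.K
        · rw [if_pos hK, mul_zero]
          split_ifs <;> linarith
        · have hmem : r ∈ (sys.idleR sys.K q)ᶜ := by simp [idleR, hK]
          rw [if_neg hK, if_pos hmem]
          refine mul_le_of_le_one_right hA ?_
          have : ((min ((q r : ℕ) + 1) sys.b : ℕ) : ℝ) ≤ (q r : ℕ) + 1 := by
            exact_mod_cast min_le_left _ _
          dsimp only
          linarith
      refine (Finset.sum_le_sum fun r _ => h1 r).trans ?_
      rw [Finset.sum_ite_mem, Finset.univ_inter]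
      by_cases ho : Overloaded q
      · have := sys.sum_arr_le P q (sys.idleR sys.K q)ᶜ
        have := mul_nonneg hN0.le hW.d₂_nonneg
        rw [if_pos ho]
        linarith
      · rw [if_neg ho]
        linarith [hW.sum_arr_compl_le P ho]
    · rw [Finset.mul_sum]
      refine Finset.sum_le_sum fun r _ => ?_
      rw [down, hupdate]
      by_cases hK : sys.serverType r ≤ sys.K
      · simp [hK]
      · rw [if_neg hK, if_neg hK]
        rcases Nat.eq_zero_or_pos (q r : ℕ) with h0 | h0
        · simp [h0]
        · have h1 : (((q r : ℕ) - 1 : ℕ) : ℝ) - (q r : ℕ) = -1 := by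
            rw [Nat.cast_sub h0]; push_cast; ring
          have h2 : ((q r : ℕ) : ℝ) ≤ sys.b := by exact_mod_cast Nat.lt_succ_iff.1 (q r).isLt
          have h3 := sys.μ_M_le_serviceRate r
          have h4 : S.μ S.M / sys.b * (q r : ℕ) ≤ S.μ S.M := by
            rw [div_mul_eq_mul_div, div_le_iff₀ hb0]
            exact mul_le_mul_of_nonneg_left h2 hμM.le
          dsimp only
          rw [h1]
          linarith
  have h1 := sum_stationary_drift_eq_zero hp.balance
    fun q : sys.State => ∑ r, if sys.serverType r ≤ sys.K then 0 else ((q r : ℕ) : ℝ)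
  have h2 := expect_le_expect hp hdrift
  rw [expect_add, expect_const_add_mul hp] at h2
  have h3 : sys.expect p (fun q => -(S.μ S.M / sys.b)
        * ∑ r, if sys.serverType r ≤ sys.K then 0 else ((q r : ℕ) : ℝ))
      = -(S.μ S.M / sys.b) * sys.expect p
        (fun q => ∑ r, if sys.serverType r ≤ sys.K then 0 else ((q r : ℕ) : ℝ)) := by
    have := expect_const_add_mul hp 0 (-(S.μ S.M / sys.b))
      fun q => ∑ r, if sys.serverType r ≤ sys.K then 0 else ((q r : ℕ) : ℝ)
    simpa only [zero_add] using this
  rw [h3] at h2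
  have h4 := mul_le_mul_of_nonneg_left (expect_overloaded_le hB hW hN hp) sys.totalRate_nonneg
  have h5 : S.μ S.M / sys.b * sys.expect p
        (fun q => ∑ r, if sys.serverType r ≤ sys.K then 0 else ((q r : ℕ) : ℝ))
      ≤ N * d₂ + sys.totalRate * (1 / N) := by
    unfold expect at h2 h4 ⊢
    linarith
  rw [div_mul_eq_mul_div, div_le_iff₀ hb0] at h5
  rw [div_mul_eq_mul_div, le_div_iff₀ hμM]
  linarith

theorem expect_jobs_le (hB : sys.BufferSize ε) (hW : sys.WellConnected ε d₁ d₂) (hN : 3 ≤ N)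
    (hp : sys.IsStationary P p) :
    sys.expect p (fun q => ∑ m ∈ Finset.Icc 1 S.M, sys.C m q)
      ≤ sys.Cstar + (1 + sys.tauKM / 2) * ε + 8 * sys.b * sys.tau1K / (ε * N)
        + sys.b * sys.tau1M / N := by
  have hN0 := sys.N_pos
  have hμM : 0 < S.μ S.M := S.μ_pos _ (Finset.mem_Icc.2 ⟨sys.one_le_K.trans sys.K_le, le_rfl⟩)
  have hb0 : (0 : ℝ) < sys.b := by linarith [hB.six_le_b]
  have hsplit : ∀ q : sys.State, ∑ m ∈ Finset.Icc 1 S.M, sys.C m q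
      ≤ ((sys.Cstar + ε) + 1 * max (∑ m ∈ Finset.Icc 1 sys.K, sys.C m q - (sys.Cstar + ε)) 0)
        + (0 + 1 / N * ∑ r, if sys.serverType r ≤ sys.K then 0 else ((q r : ℕ) : ℝ)) := by
    intro q
    have h1 := sys.N_mul_sum_C S.M q
    have h2 := sys.N_mul_sum_C sys.K q
    have h3 : (∑ r, if sys.serverType r ≤ S.M then ((q r : ℕ) : ℝ) else 0)
        = (∑ r, if sys.serverType r ≤ sys.K then ((q r : ℕ) : ℝ) else 0)
          + ∑ r, if sys.serverType r ≤ sys.K then 0 else ((q r : ℕ) : ℝ) := by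
      rw [← Finset.sum_add_distrib]
      refine Finset.sum_congr rfl fun r _ => ?_
      rw [if_pos (Finset.mem_Icc.1 (sys.serverType_mem r)).2]
      split_ifs <;> simp
    have h4 : ∑ m ∈ Finset.Icc 1 S.M, sys.C m q = ∑ m ∈ Finset.Icc 1 sys.K, sys.C m q
        + 1 / N * ∑ r, if sys.serverType r ≤ sys.K then 0 else ((q r : ℕ) : ℝ) := by
      refine mul_left_cancel₀ hN0.ne' ?_
      rw [h1, h3, mul_add, h2, ← mul_assoc, mul_one_div_cancel hN0.ne', one_mul]
    have h5 := le_max_left (∑ m ∈ Finset.Icc 1 sys.K, sys.C m q - (sys.Cstar + ε)) 0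
    rw [h4]
    linarith
  have h1 := expect_le_expect hp hsplit
  rw [expect_add, expect_const_add_mul hp, expect_const_add_mul hp] at h1
  have h2 := expect_excess_le hB hW hN hp
  have h3 := mul_le_mul_of_nonneg_left (expect_slow_jobs_le hB hW hN hp)
    (by positivity : (0 : ℝ) ≤ 1 / N)
  have h4 : 1 / (N : ℝ) * (sys.b / S.μ S.M * (N * d₂ + sys.totalRate * (1 / N)))
      ≤ sys.tauKM / 2 * ε + sys.b * sys.tau1M / N := by
    have h6 := sys.totalRate_le
    calc _ ≤ 1 / (N : ℝ) * (sys.b / S.μ S.M * (N * (ε * S.μ sys.K / (2 * sys.b))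
          + N * S.μ 1 * (1 / N))) := by
          gcongr
          exact hW.d₂_le
      _ = _ := by rw [tauKM, tau1M]; field_simp
  linarith

/-- The numerical comparison of the errors in `expect_jobs_le` with a square root. -/
theorem errors_le_sqrt (hB : sys.BufferSize ε) (hN : 3 ≤ N) (hNτ : S.μ 1 / S.μ S.M ≤ N) :
    8 * sys.b * sys.tau1K / (ε * N) + sys.b * sys.tau1M / N
      ≤ 60 * (sys.b : ℝ) ^ 2
        * Real.sqrt (26 * sys.tau1K * sys.tau1M / (sys.betaHat * ε * N)) := by
  have hN0 := sys.N_pos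
  have hε := hB.eps_pos
  have hε4 := hB.eps_le_quarter
  have hτ1 := sys.one_le_tau1K
  have hb6 := hB.six_le_b
  have hμM : 0 < S.μ S.M := S.μ_pos _ (Finset.mem_Icc.2 ⟨sys.one_le_K.trans sys.K_le, le_rfl⟩)
  have hM1 : 1 ≤ sys.tau1M := by
    rw [tau1M, one_le_div hμM]
    exact μ_anti le_rfl (sys.one_le_K.trans sys.K_le) le_rfl
  have hMN : sys.tau1M ≤ N := hNτ
  have hβ0 : 0 < sys.betaHat := by linarith [hB.eps_le]
  have hβ1 : sys.betaHat ≤ 1 := sys.betaHat_le_sum_α.trans sys.sum_α_le_one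
  have hE := hB.le_N_mul_eps hN
  have hpow := hB.pow_le' hN
  have hb5 : 1 ≤ (sys.b : ℝ) ^ 5 := one_le_pow₀ (by linarith)
  have hτN : 1152 * sys.tau1K ≤ ε ^ 2 * N := by nlinarith
  have hεN : ε ^ 2 * N ≤ ε * N := by nlinarith [mul_pos hε hN0]
  have h1 : 8 * sys.tau1K / (ε * N)
      ≤ Real.sqrt (26 * sys.tau1K * sys.tau1M / (sys.betaHat * ε * N)) := by
    refine Real.le_sqrt_of_sq_le ?_
    rw [div_pow, div_le_div_iff₀ (by positivity) (by positivity)]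
    have h3 : 64 * sys.tau1K * sys.betaHat ≤ 26 * sys.tau1M * (ε * N) := by
      have h4 : sys.tau1K * sys.betaHat ≤ sys.tau1K := mul_le_of_le_one_right (by linarith) hβ1
      have h5 : ε * N ≤ sys.tau1M * (ε * N) := le_mul_of_one_le_left (by positivity) hM1
      nlinarith
    calc (8 * sys.tau1K) ^ 2 * (sys.betaHat * ε * N)
        = 64 * sys.tau1K * sys.betaHat * (sys.tau1K * ε * N) := by ring
      _ ≤ 26 * sys.tau1M * (ε * N) * (sys.tau1K * ε * N) :=
          mul_le_mul_of_nonneg_right h3 (by positivity)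
      _ = _ := by ring
  have h2 : sys.tau1M / N
      ≤ Real.sqrt (26 * sys.tau1K * sys.tau1M / (sys.betaHat * ε * N)) := by
    refine Real.le_sqrt_of_sq_le ?_
    rw [div_pow, div_le_div_iff₀ (by positivity) (by positivity)]
    have h3 : sys.tau1M * (sys.betaHat * ε) ≤ 26 * sys.tau1K * N := by
      have h4 : sys.betaHat * ε ≤ 1 := by nlinarith
      have h5 : sys.tau1M * (sys.betaHat * ε) ≤ sys.tau1M :=
        mul_le_of_le_one_right (by linarith) h4
      nlinarith
    calc sys.tau1M ^ 2 * (sys.betaHat * ε * N)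
        = sys.tau1M * (sys.betaHat * ε) * (sys.tau1M * N) := by ring
      _ ≤ 26 * sys.tau1K * N * (sys.tau1M * N) := mul_le_mul_of_nonneg_right h3 (by positivity)
      _ = _ := by ring
  have hb2 : (sys.b : ℝ) ≤ (sys.b : ℝ) ^ 2 := le_self_pow₀ (by linarith) (by norm_num)
  have hs := Real.sqrt_nonneg (26 * sys.tau1K * sys.tau1M / (sys.betaHat * ε * N))
  calc 8 * sys.b * sys.tau1K / (ε * N) + sys.b * sys.tau1M / N
      = sys.b * (8 * sys.tau1K / (ε * N) + sys.tau1M / N) := by ring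
    _ ≤ sys.b * (2 * Real.sqrt (26 * sys.tau1K * sys.tau1M / (sys.betaHat * ε * N))) :=
        mul_le_mul_of_nonneg_left (by linarith) (by linarith)
    _ ≤ (sys.b : ℝ) ^ 2
          * (60 * Real.sqrt (26 * sys.tau1K * sys.tau1M / (sys.betaHat * ε * N))) :=
        mul_le_mul hb2 (by linarith) (by positivity) (by positivity)
    _ = _ := by ring

end LBSystem

theorem theorem1 (S : ServerTypes) :
    ∃ N₀ : ℕ, ∀ N : ℕ, N₀ ≤ N → ∀ (sys : LBSystem S N) (P : Policy) (ε d₁ d₂ : ℝ),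
      sys.BufferSize ε → sys.WellConnected ε d₁ d₂ →
      ∀ p : sys.State → ℝ, sys.IsStationary P p →
        sys.expect p (fun q =>
            max (∑ m ∈ Finset.Icc 1 sys.K, sys.C m q - (sys.Cstar + ε)) 0)
          ≤ 52 * sys.tau1K * (sys.b : ℝ) ^ 2 / (ε * N) ∧
        (sys.K < S.M →
          sys.expect p (fun q => ∑ m ∈ Finset.Icc 1 S.M, sys.C m q)
            ≤ sys.Cstar + (1 + sys.tauKM / 2) * ε
              + 2 * Real.sqrt (5 * sys.tau1M * sys.b * Real.log N / N)
              + 60 * (sys.b : ℝ) ^ 2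
                * Real.sqrt (26 * sys.tau1K * sys.tau1M / (sys.betaHat * ε * N))) ∧
        (0 < sys.lam →
          sys.blockProb P p ≤ d₂ / sys.lam + 52 * sys.tau1K * (sys.b : ℝ) ^ 2 / (ε * N)) := by
  refine ⟨max 3 ⌈S.μ 1 / S.μ S.M⌉₊, fun N hN₀ sys P ε d₁ d₂ hB hW p hp => ?_⟩
  have hN : 3 ≤ N := (le_max_left _ _).trans hN₀
  have hNτ : S.μ 1 / S.μ S.M ≤ N := Nat.ceil_le.1 ((le_max_right _ _).trans hN₀)
  have hN0 := sys.N_pos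
  have hε := hB.eps_pos
  have hε4 := hB.eps_le_quarter
  have hτ := sys.one_le_tau1K
  have hb6 := hB.six_le_b
  have hb2 : (sys.b : ℝ) ≤ (sys.b : ℝ) ^ 2 := le_self_pow₀ (by linarith) (by norm_num)
  refine ⟨(LBSystem.expect_excess_le hB hW hN hp).trans ?_, fun _ => ?_, fun hlam =>
    (LBSystem.blockProb_le hB hW hN hp hlam).trans ?_⟩
  · refine div_le_div_of_nonneg_right ?_ (by positivity)
    nlinarith [mul_le_mul_of_nonneg_left hb2 (by linarith : 0 ≤ sys.tau1K)]
  · have h1 := LBSystem.expect_jobs_le hB hW hN hp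
    have h2 := LBSystem.errors_le_sqrt hB hN hNτ
    have h3 := Real.sqrt_nonneg (5 * sys.tau1M * sys.b * Real.log N / N)
    linarith
  · have h1 : 1 / (N : ℝ) ≤ 52 * sys.tau1K * (sys.b : ℝ) ^ 2 / (ε * N) := by
      rw [div_le_div_iff₀ hN0 (by positivity)]
      have h2 : 1 ≤ sys.tau1K * (sys.b : ℝ) ^ 2 :=
        one_le_mul_of_one_le_of_one_le hτ (one_le_pow₀ (by linarith))
      nlinarith [mul_le_mul_of_nonneg_right h2 hN0.le, mul_le_mul_of_nonneg_right hε4 hN0.le]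
    linarith
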